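/- Let $\mathcal E$ be a category with pullbacks. For $f:A\to B$ write $\Sigma_f:\mathcal E/A\to\mathcal E/B$ for composition with $f$, $\Delta_f:\mathcal E/B\to\mathcal E/A$ for its right adjoint (pullback along $f$), and, when it exists, $\Pi_f$ for the right adjoint of $\Delta_f$; $f$ is exponentiable if $\Pi_f$ exists. Fix a choice of pullbacks and of the existing functors $\Pi_f$. The bicategory $\mathbf{Poly}_c(\mathcal E)$ has the objects of $\mathcal E$ as objects. A 1-cell $p:X\to Y$ is a polynomial $X\xleftarrow{p_1}A\xrightarrow{p_2}B\xrightarrow{p_3}Y$ with $p_2$ exponentiable. A 2-cell $f:p\to q$, with $q=(X\xleftarrow{q_1}A'\xrightarrow{q_2}B'\xrightarrow{q_3}Y)$, is a cartesian morphism: maps $f_0:A\to A'$, $f_1:B\to B'$ with $q_1f_0=p_1$, $q_3f_1=p_3$, such that $q_2f_0=f_1p_2$ is a pullback square; vertical composition is componentwise. Identities are $1_X=(X\xleftarrow{1}X\xrightarrow{1}X\xrightarrow{1}X)$. For $p:X\to Y$ as above and $q=(Y\xleftarrow{q_1}C\xrightarrow{q_2}D\xrightarrow{q_3}Z)$, the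 composite $q\circ p$ is obtained as follows. Let $d:G\to D$ be $\Pi_{q_2}\Delta_{q_1}(p_3)$, let $M=G\times_DC$, let $b:M\to B$ be the composite of the counit $M\to B\times_YC$ of $\Delta_{q_2}\dashv\Pi_{q_2}$ with the projection to $B$, and let $F=A\times_BM$. Then $q\circ p=(X\leftarrow F\to G\to Z)$, where $F\to X$ is the projection $F\to A$ followed by $p_1$, the map $F\to G$ is the composite of the projections $F\to M\to G$, and $G\to Z$ is $q_3d$. Horizontal composites of 2-cells, the associativity isomorphisms $\alpha_{r,q,p}:(r\circ q)\circ p\cong r\circ(q\circ p)$ and the unit isomorphisms $p\circ 1_X\cong p$ and $\rho_p:1_Y\circ p\cong p$ are those induced by the universal property of these composites. For a cartesian morphism $f:p\to q$ of polynomials from $X$ to $Y$, let $\mathbf P_{\mathcal E}(f)$ be the composite transformation $$\Sigma_{p_3}\Pi_{p_2}\Delta_{p_1}\cong\Sigma_{p_3}\Pi_{p_2}\Delta_{f_0}\Delta_{q_1}\cong\Sigma_{p_3}\Delta_{f_1}\Pi_{q_2}\Delta_{q_1}\longrightarrow\Sigma_{q_3}\Pi_{q_2}\Delta_{q_1},$$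 in which the first isomorphism is the canonical one $\Delta_{p_1}\cong\Delta_{f_0}\Delta_{q_1}$, the second is the inverse of the right Beck--Chevalley isomorphism $\Delta_{f_1}\Pi_{q_2}\cong\Pi_{p_2}\Delta_{f_0}$ of the pullback square (obtained, by taking right adjoints, from the left Beck--Chevalley isomorphism $\Sigma_{f_0}\Delta_{p_2}\cong\Delta_{q_2}\Sigma_{f_1}$, the mate of the identity $\Sigma_{q_2}\Sigma_{f_0}=\Sigma_{f_1}\Sigma_{p_2}$), and the last is induced by the mate $\Sigma_{p_3}\Delta_{f_1}\to\Sigma_{q_3}$ of the identity $\Sigma_{p_3}=\Sigma_{q_3}\Sigma_{f_1}$ under $\Sigma_{f_1}\dashv\Delta_{f_1}$. Let $r_{X,Y}:\mathbf{Poly}_c(\mathcal E)(X,Y)\to\mathcal E/Y$ be the right projection $p\mapsto p_3$, $f\mapsto f_1$, and for $x:C\to X$ let $x^\bullet:C\to X$ be the polynomial $C\xleftarrow{1}C\xrightarrow{1}C\xrightarrow{x}X$; with the choices above, $r_{C,Y}(p\circ x^\bullet)=\Sigma_{p_3}\Pi_{p_2}\Delta_{p_1}(x)$. **Theorem.** The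 assignments $X\mapsto\mathcal E/X$, $p\mapsto\mathbf P_{\mathcal E}(p)=\Sigma_{p_3}\Pi_{p_2}\Delta_{p_1}$, $f\mapsto\mathbf P_{\mathcal E}(f)$ are the object, 1-cell and 2-cell maps of a homomorphism of bicategories (pseudofunctor) $$\mathbf P_{\mathcal E}:\mathbf{Poly}_c(\mathcal E)\to\mathbf{CAT}$$ whose coherence isomorphisms are the following. For $p:X\to Y$, $q:Y\to Z$, the isomorphism $\mathbf P_{\mathcal E}(q)\mathbf P_{\mathcal E}(p)\cong\mathbf P_{\mathcal E}(q\circ p)$ has as component at $x:C\to X$ the right projection $r_{C,Z}(\alpha^{-1}_{q,p,x^\bullet})$ of the associativity isomorphism $\alpha^{-1}_{q,p,x^\bullet}:q\circ(p\circ x^\bullet)\cong(q\circ p)\circ x^\bullet$. The isomorphism $\mathbf P_{\mathcal E}(1_X)\cong 1_{\mathcal E/X}$ has as component at $x:C\to X$ the right projection $r_{C,X}(\rho_{x^\bullet})$ of the unit isomorphism $\rho_{x^\bullet}:1_X\circ x^\bullet\cong x^\bullet$. -/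

import Mathlib

open CategoryTheory Limits Category
universe v u
namespace PolyCart
variable {E : Type u} [Category.{v} E] [HasPullbacks E]

/-- A morphism `f` is exponentiable if the pullback functor `Δ_f` has a right adjoint. -/
abbrev Exponentiable {X Y : E} (f : X ⟶ Y) : Prop := (Over.pullback f).IsLeftAdjoint

theorem exponentiable_id (X : E) : Exponentiable (𝟙 X) :=
  Functor.isLeftAdjoint_of_iso Over.pullbackId.symm

theorem exponentiable_comp {X Y Z : E} (f : X ⟶ Y) (g : Y ⟶ Z) (hf : Exponentiable f)
    (hg : Exponentiable g) : Exponentiable (f ≫ g) :=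
  Functor.isLeftAdjoint_of_iso (Over.pullbackComp f g).symm

theorem exponentiable_of_isPullback {A A' B B' : E} {h : A' ⟶ A} {f' : A' ⟶ B'} {f : A ⟶ B}
    {k : B' ⟶ B} (sq : IsPullback h f' f k) (hf : Exponentiable f) : Exponentiable f' := by
  let e := sq.flip.isoPullback
  let F : Over B' ⥤ Over A' := (Over.mk k).iteratedSliceEquiv.inverse ⋙
    Over.post (X := Over.mk k) (Over.pullback f) ⋙
    ((Over.pullback f).obj (Over.mk k)).iteratedSliceEquiv.functor ⋙ (Over.mapIso e.symm).functor
  have : F.IsLeftAdjoint := by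
    change ((Over.mk k).iteratedSliceEquiv.inverse ⋙ _).IsLeftAdjoint
    infer_instance
  have he1 : e.hom ≫ pullback.fst k f = f' := sq.flip.isoPullback_hom_fst
  have he2 : e.hom ≫ pullback.snd k f = h := sq.flip.isoPullback_hom_snd
  have pb {Y : E} (y : Y ⟶ B') :
      IsPullback (pullback.fst y f') (pullback.snd y f' ≫ h) (y ≫ k) f :=
    ((IsPullback.of_hasPullback y f').flip.paste_horiz sq).flip
  have h1 {Y : E} (y : Y ⟶ B') : (pb y).isoPullback.inv ≫ pullback.snd y f' =
      pullback.lift (f := k) (g := f) (pullback.fst (y ≫ k) f ≫ y)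
        (pullback.snd (y ≫ k) f) (by simp [pullback.condition]) ≫ e.inv := by
    rw [Iso.inv_comp_eq, ← assoc, Iso.eq_comp_inv]
    apply pullback.hom_ext
    · simp [he1, pullback.condition, pullback.lift_fst]
    · simp [he2, pullback.lift_snd]
  have h2 {Y Z : E} (y : Y ⟶ B') (z : Z ⟶ B') (g : Y ⟶ Z) (w : g ≫ z = y) :
      pullback.lift (f := z ≫ k) (g := f) (pullback.fst (y ≫ k) f ≫ g)
        (pullback.snd (y ≫ k) f) (by simp [← pullback.condition, ← w]) ≫
        (pb z).isoPullback.inv = (pb y).isoPullback.inv ≫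
          pullback.lift (f := z) (g := f') (pullback.fst y f' ≫ g) (pullback.snd y f')
          (by simp [← pullback.condition, ← w]) := by
    rw [Iso.eq_inv_comp, ← assoc, Iso.comp_inv_eq]
    apply pullback.hom_ext
    · simp [pullback.lift_fst]
    · simp [pullback.lift_snd, pullback.lift_snd_assoc]
  have i : F ≅ Over.pullback f' := NatIso.ofComponents
    (fun y => Over.isoMk ((pb y.hom).isoPullback.symm) (h1 y.hom)) (by
      intro y z g
      ext
      exact h2 y.hom z.hom g.left (Over.w g))
  exact Functor.isLeftAdjoint_of_iso i

theorem eq_isoPullback_hom_map {A B U M : E} {q : A ⟶ B} {c : U ⟶ B} {a : M ⟶ A} {v : M ⟶ U}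
    (pb : IsPullback v a c q) {z : Over B} (D : Over.mk c ⟶ z)
    {m : M ⟶ pullback z.hom q} (h₁ : m ≫ pullback.fst _ _ = v ≫ D.left)
    (h₂ : m ≫ pullback.snd _ _ = a) :
    m = pb.isoPullback.hom ≫ ((Over.pullback q).map D).left := by
  have e₁ : ((Over.pullback q).map D).left ≫ pullback.fst z.hom q = pullback.fst c q ≫ D.left :=
    pullback.lift_fst _ _ _
  have e₂ : ((Over.pullback q).map D).left ≫ pullback.snd z.hom q = pullback.snd c q :=
    pullback.lift_snd _ _ _
  apply pullback.hom_ext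
  · rw [assoc]
    refine Eq.trans ?_ (congrArg (pb.isoPullback.hom ≫ ·) e₁.symm)
    simp [h₁]
  · rw [assoc]
    refine Eq.trans ?_ (congrArg (pb.isoPullback.hom ≫ ·) e₂.symm)
    simp [h₂]

section Distributivity
variable {A B : E} (q : A ⟶ B) [Exponentiable q] (w : Over A)

/-- The functor `Π_q : E/A ⥤ E/B`, right adjoint to pulling back along `q`. -/
noncomputable abbrev piFunctor : Over A ⥤ Over B := (Over.pullback q).rightAdjoint

/-- The adjunction `Δ_q ⊣ Π_q`. -/
noncomputable abbrev piAdj : Over.pullback q ⊣ piFunctor q :=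
  Adjunction.ofIsLeftAdjoint (Over.pullback q)

/-- The counit of `Δ_q ⊣ Π_q`. -/
noncomputable def piEv : pullback ((piFunctor q).obj w).hom q ⟶ w.left :=
  ((piAdj q).counit.app w).left

theorem piEv_hom : piEv q w ≫ w.hom = pullback.snd _ _ := Over.w ((piAdj q).counit.app w)

variable {q w} {U M : E} {c : U ⟶ B} {a : M ⟶ A} {v : M ⟶ U}

/-- The morphism into `Π_q w` induced by a pullback around `(q, w)`. -/
noncomputable def piLift (pb : IsPullback v a c q) (b : M ⟶ w.left) (hb : b ≫ w.hom = a) :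
    U ⟶ ((piFunctor q).obj w).left :=
  ((piAdj q).homEquiv (Over.mk c) w (Over.homMk (pb.isoPullback.inv ≫ b)
    (by simp [hb]))).left

theorem piLift_hom (pb : IsPullback v a c q) (b : M ⟶ w.left) (hb : b ≫ w.hom = a) :
    piLift pb b hb ≫ ((piFunctor q).obj w).hom = c :=
  Over.w ((piAdj q).homEquiv (Over.mk c) w (Over.homMk (pb.isoPullback.inv ≫ b) _))

theorem piLift_ev (pb : IsPullback v a c q) (b : M ⟶ w.left) (hb : b ≫ w.hom = a)
    (m : M ⟶ pullback ((piFunctor q).obj w).hom q)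
    (h₁ : m ≫ pullback.fst _ _ = v ≫ piLift pb b hb) (h₂ : m ≫ pullback.snd _ _ = a) :
    m ≫ piEv q w = b := by
  let g : (Over.pullback q).obj (Over.mk c) ⟶ w := Over.homMk (pb.isoPullback.inv ≫ b)
    (by simp [hb])
  have key : (Over.pullback q).map ((piAdj q).homEquiv (Over.mk c) w g) ≫ (piAdj q).counit.app w
      = g := by
    exact (Adjunction.homEquiv_counit ..).symm.trans (Equiv.symm_apply_apply _ _)
  have key' : ((Over.pullback q).map ((piAdj q).homEquiv (Over.mk c) w g)).left ≫ piEv q w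
      = pb.isoPullback.inv ≫ b := congrArg (fun z => z.left) key
  have hm : m = pb.isoPullback.hom ≫
      ((Over.pullback q).map ((piAdj q).homEquiv (Over.mk c) w g)).left :=
    eq_isoPullback_hom_map pb _ h₁ h₂
  rw [hm, assoc, key', Iso.hom_inv_id_assoc]

theorem pi_hom_ext (pb : IsPullback v a c q) {d d' : U ⟶ ((piFunctor q).obj w).left}
    {m m' : M ⟶ pullback ((piFunctor q).obj w).hom q}
    (hd : d ≫ ((piFunctor q).obj w).hom = c) (hd' : d' ≫ ((piFunctor q).obj w).hom = c)
    (h₁ : m ≫ pullback.fst _ _ = v ≫ d) (h₂ : m ≫ pullback.snd _ _ = a)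
    (h₁' : m' ≫ pullback.fst _ _ = v ≫ d') (h₂' : m' ≫ pullback.snd _ _ = a)
    (h : m ≫ piEv q w = m' ≫ piEv q w) : d = d' := by
  let D : Over.mk c ⟶ (piFunctor q).obj w := Over.homMk d hd
  let D' : Over.mk c ⟶ (piFunctor q).obj w := Over.homMk d' hd'
  have hm : m = pb.isoPullback.hom ≫ ((Over.pullback q).map D).left :=
    eq_isoPullback_hom_map pb _ h₁ h₂
  have hm' : m' = pb.isoPullback.hom ≫ ((Over.pullback q).map D').left :=
    eq_isoPullback_hom_map pb _ h₁' h₂'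
  have : D = D' := by
    apply ((piAdj q).homEquiv _ _).symm.injective
    rw [Adjunction.homEquiv_counit, Adjunction.homEquiv_counit]
    ext
    rw [hm, hm', assoc, assoc] at h
    exact (Iso.cancel_iso_hom_left _ _ _).mp h
  exact congrArg (fun z => z.left) this

end Distributivity

/-- A polynomial from `X` to `Y`: a diagram `X ⟵ A ⟶ B ⟶ Y` whose middle map is exponentiable. -/
structure Poly (X Y : E) where
  {A B : E}
  p₁ : A ⟶ X
  p₂ : A ⟶ B
  p₃ : B ⟶ Y
  exp : Exponentiable p₂

attribute [instance] Poly.exp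

/-- A cartesian morphism of polynomials: maps `f₀` and `f₁` which make the diagram commute and whose
middle square is a pullback. -/
@[ext]
structure Poly.Hom {X Y : E} (P Q : Poly X Y) where
  f₀ : P.A ⟶ Q.A
  f₁ : P.B ⟶ Q.B
  w₁ : f₀ ≫ Q.p₁ = P.p₁
  w₃ : f₁ ≫ Q.p₃ = P.p₃
  pb : IsPullback f₀ P.p₂ Q.p₂ f₁

attribute [simp] Poly.Hom.w₁ Poly.Hom.w₃

/-- The category of polynomials from `X` to `Y` and cartesian morphisms. -/
instance (X Y : E) : Category (Poly X Y) where
  Hom := Poly.Hom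
  id P := ⟨𝟙 _, 𝟙 _, by simp, by simp, .of_id_fst⟩
  comp f g := ⟨f.f₀ ≫ g.f₀, f.f₁ ≫ g.f₁, by rw [assoc, g.w₁, f.w₁], by rw [assoc, g.w₃, f.w₃],
    f.pb.paste_horiz g.pb⟩
  id_comp f := by ext <;> simp
  comp_id f := by ext <;> simp
  assoc f g h := by ext <;> simp

namespace Poly

@[simp] theorem id_f₀ {X Y : E} (P : Poly X Y) : Hom.f₀ (𝟙 P) = 𝟙 P.A := rfl
@[simp] theorem id_f₁ {X Y : E} (P : Poly X Y) : Hom.f₁ (𝟙 P) = 𝟙 P.B := rfl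
@[simp] theorem comp_f₀ {X Y : E} {P Q R : Poly X Y} (f : P ⟶ Q) (g : Q ⟶ R) :
    (f ≫ g).f₀ = f.f₀ ≫ g.f₀ := rfl
@[simp] theorem comp_f₁ {X Y : E} {P Q R : Poly X Y} (f : P ⟶ Q) (g : Q ⟶ R) :
    (f ≫ g).f₁ = f.f₁ ≫ g.f₁ := rfl

theorem hom_ext {X Y : E} {P Q : Poly X Y} {f g : P ⟶ Q} (h₀ : f.f₀ = g.f₀) (h₁ : f.f₁ = g.f₁) :
    f = g := Hom.ext h₀ h₁

/-- The identity polynomial. -/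
def idPoly (X : E) : Poly X X := ⟨𝟙 X, 𝟙 X, 𝟙 X, exponentiable_id X⟩

/-- The polynomial functor `Σ_{p₃} Π_{p₂} Δ_{p₁} : E/X ⥤ E/Y`. -/
noncomputable def functor {X Y : E} (P : Poly X Y) : Over X ⥤ Over Y :=
  Over.pullback P.p₁ ⋙ piFunctor P.p₂ ⋙ Over.map P.p₃

section Composite
variable {X Y Z : E} (P : Poly X Y) (Q : Poly Y Z)

/-- The distributivity pullback of `Δ_{q₁} p₃` along `q₂`. -/
noncomputable abbrev compD : Over Q.B :=
  (piFunctor Q.p₂).obj ((Over.pullback Q.p₁).obj (Over.mk P.p₃))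

/-- The middle object of the subdivided composite. -/
noncomputable abbrev compM : E := pullback (compD P Q).hom Q.p₂

/-- The map from the middle object to `B`. -/
noncomputable def compB : compM P Q ⟶ P.B :=
  piEv Q.p₂ ((Over.pullback Q.p₁).obj (Over.mk P.p₃)) ≫ pullback.fst P.p₃ Q.p₁

theorem compB_p₃ : compB P Q ≫ P.p₃ = pullback.snd (compD P Q).hom Q.p₂ ≫ Q.p₁ := by
  have h : piEv Q.p₂ ((Over.pullback Q.p₁).obj (Over.mk P.p₃)) ≫ pullback.snd P.p₃ Q.p₁ =
    pullback.snd (compD P Q).hom Q.p₂ := piEv_hom Q.p₂ ((Over.pullback Q.p₁).obj (Over.mk P.p₃))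
  rw [← h, compB, assoc, assoc, pullback.condition]

/-- The composite polynomial `Q ∘ P`: form the distributivity pullback around `q₂` and the pullback
of `p₃` along `q₁`, and then pull back `p₂`. -/
noncomputable abbrev comp : Poly X Z where
  A := pullback P.p₂ (compB P Q)
  B := (compD P Q).left
  p₁ := pullback.fst P.p₂ (compB P Q) ≫ P.p₁
  p₂ := pullback.snd P.p₂ (compB P Q) ≫ pullback.fst (compD P Q).hom Q.p₂
  p₃ := (compD P Q).hom ≫ Q.p₃
  exp := exponentiable_comp _ _
    (exponentiable_of_isPullback (IsPullback.of_hasPullback P.p₂ (compB P Q)) P.exp)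
    (exponentiable_of_isPullback (IsPullback.of_hasPullback (compD P Q).hom Q.p₂).flip Q.exp)

end Composite

/-- A factorisation of a polynomial from `X` to `Z` into polynomials from `X` to `Y` and from
`Y` to `Z` whose middle maps are composable. -/
structure Fact {X Z : E} (W : Poly X Z) (Y : E) where
  {M : E}
  u : W.A ⟶ M
  v : M ⟶ W.B
  y : M ⟶ Y
  hu : Exponentiable u
  hv : Exponentiable v
  fac : u ≫ v = W.p₂

namespace Fact
variable {X Y Z : E} {W : Poly X Z}

/-- The first part of a factorisation. -/
abbrev fst (F : Fact W Y) : Poly X Y := ⟨W.p₁, F.u, F.y, F.hu⟩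

/-- The second part of a factorisation. -/
abbrev snd (F : Fact W Y) : Poly Y Z := ⟨F.y, F.v, W.p₃, F.hv⟩

end Fact

section Lift
variable {X Y Z : E} (P : Poly X Y) (Q : Poly Y Z)

/-- The canonical factorisation of a composite. -/
noncomputable abbrev canon : Fact (comp P Q) Y where
  u := pullback.snd P.p₂ (compB P Q)
  v := pullback.fst (compD P Q).hom Q.p₂
  y := compB P Q ≫ P.p₃
  hu := exponentiable_of_isPullback (IsPullback.of_hasPullback P.p₂ (compB P Q)) P.exp
  hv := exponentiable_of_isPullback (IsPullback.of_hasPullback (compD P Q).hom Q.p₂).flip Q.exp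
  fac := rfl

/-- The comparison of the first part of the canonical factorisation with the first polynomial. -/
noncomputable abbrev canonFst : (canon P Q).fst ⟶ P where
  f₀ := pullback.fst P.p₂ (compB P Q)
  f₁ := compB P Q
  w₁ := rfl
  w₃ := rfl
  pb := IsPullback.of_hasPullback P.p₂ (compB P Q)

/-- The comparison of the second part of the canonical factorisation with the second
polynomial. -/
noncomputable abbrev canonSnd : (canon P Q).snd ⟶ Q where
  f₀ := pullback.snd (compD P Q).hom Q.p₂
  f₁ := (compD P Q).hom
  w₁ := (compB_p₃ P Q).symm
  w₃ := rfl
  pb := (IsPullback.of_hasPullback (compD P Q).hom Q.p₂).flip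

variable {P Q} {W : Poly X Z} (F : Fact W Y) (φ : F.fst ⟶ P) (ψ : F.snd ⟶ Q)

/-- The induced map into the distributivity pullback. -/
noncomputable def liftB : W.B ⟶ (comp P Q).B :=
  piLift (w := (Over.pullback Q.p₁).obj (Over.mk P.p₃)) ψ.pb.flip
    (pullback.lift (f := P.p₃) (g := Q.p₁) φ.f₁ ψ.f₀ (φ.w₃.trans ψ.w₁.symm)) (pullback.lift_snd _ _ _)

theorem liftB_c : liftB F φ ψ ≫ (canonSnd P Q).f₁ = ψ.f₁ := piLift_hom _ _ _

/-- The induced map into the middle object of the subdivided composite. -/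
noncomputable def liftM : F.M ⟶ (canon P Q).M :=
  pullback.lift (f := (compD P Q).hom) (g := Q.p₂) (F.v ≫ liftB F φ ψ) ψ.f₀
    (by rw [assoc]; exact (congrArg (F.v ≫ ·) (liftB_c F φ ψ)).trans ψ.pb.w.symm)

theorem liftM_v : liftM F φ ψ ≫ (canon P Q).v = F.v ≫ liftB F φ ψ := pullback.lift_fst _ _ _

theorem liftM_a : liftM F φ ψ ≫ (canonSnd P Q).f₀ = ψ.f₀ := pullback.lift_snd _ _ _

theorem liftM_b : liftM F φ ψ ≫ (canonFst P Q).f₁ = φ.f₁ := by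
  have := piLift_ev (w := (Over.pullback Q.p₁).obj (Over.mk P.p₃)) ψ.pb.flip
    (pullback.lift (f := P.p₃) (g := Q.p₁) φ.f₁ ψ.f₀ (φ.w₃.trans ψ.w₁.symm))
    (pullback.lift_snd _ _ _) (liftM F φ ψ) (liftM_v F φ ψ) (liftM_a F φ ψ)
  exact (assoc _ _ _).symm.trans ((congrArg (· ≫ pullback.fst P.p₃ Q.p₁) this).trans
    (pullback.lift_fst _ _ _))

/-- The induced map into the first object of the composite. -/
noncomputable def liftA : W.A ⟶ (comp P Q).A :=
  pullback.lift (f := P.p₂) (g := compB P Q) φ.f₀ (F.u ≫ liftM F φ ψ)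
    (by rw [assoc]; exact φ.pb.w.trans (congrArg (F.u ≫ ·) (liftM_b F φ ψ).symm))

theorem liftA_a₀ : liftA F φ ψ ≫ (canonFst P Q).f₀ = φ.f₀ := pullback.lift_fst _ _ _

theorem liftA_u : liftA F φ ψ ≫ (canon P Q).u = F.u ≫ liftM F φ ψ := pullback.lift_snd _ _ _

theorem liftA_pb : IsPullback (liftA F φ ψ) F.u (canon P Q).u (liftM F φ ψ) := by
  refine IsPullback.of_right ?_ (liftA_u F φ ψ) (canonFst P Q).pb
  rw [liftA_a₀, liftM_b]
  exact φ.pb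

theorem liftM_pb : IsPullback (liftM F φ ψ) F.v (canon P Q).v (liftB F φ ψ) := by
  refine IsPullback.of_right ?_ (liftM_v F φ ψ) (canonSnd P Q).pb
  rw [liftM_a, liftB_c]
  exact ψ.pb

/-- The morphism into a composite induced by a factorisation and morphisms of its parts. -/
noncomputable def lift : W ⟶ comp P Q where
  f₀ := liftA F φ ψ
  f₁ := liftB F φ ψ
  w₁ := by
    refine Eq.trans ?_ φ.w₁
    rw [← liftA_a₀ F φ ψ, assoc]
  w₃ := by
    refine Eq.trans ?_ ψ.w₃
    rw [← liftB_c F φ ψ, assoc]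
  pb := by
    have := (liftA_pb F φ ψ).paste_vert (liftM_pb F φ ψ)
    rw [F.fac] at this
    exact this

/-- Uniqueness of the induced morphism. -/
theorem eq_lift (θ : W ⟶ comp P Q) (m : F.M ⟶ (canon P Q).M)
    (h₀ : θ.f₀ ≫ (canonFst P Q).f₀ = φ.f₀) (hu : θ.f₀ ≫ (canon P Q).u = F.u ≫ m)
    (hb : m ≫ (canonFst P Q).f₁ = φ.f₁) (ha : m ≫ (canonSnd P Q).f₀ = ψ.f₀)
    (hv : m ≫ (canon P Q).v = F.v ≫ θ.f₁) (hc : θ.f₁ ≫ (canonSnd P Q).f₁ = ψ.f₁) :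
    θ = lift F φ ψ := by
  have e₁ : θ.f₁ = liftB F φ ψ := by
    refine pi_hom_ext (m := m) (m' := liftM F φ ψ) ψ.pb.flip hc (liftB_c F φ ψ) hv ha
      (liftM_v F φ ψ) (liftM_a F φ ψ) ?_
    apply pullback.hom_ext (f := P.p₃) (g := Q.p₁)
    · rw [assoc, assoc]; exact hb.trans (liftM_b F φ ψ).symm
    · have h := piEv_hom Q.p₂ ((Over.pullback Q.p₁).obj (Over.mk P.p₃))
      rw [assoc, assoc]
      exact (congrArg (m ≫ ·) h).trans ((ha.trans (liftM_a F φ ψ).symm).trans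
        (congrArg (liftM F φ ψ ≫ ·) h).symm)
  have em : m = liftM F φ ψ := by
    apply (canonSnd P Q).pb.hom_ext
    · exact ha.trans (liftM_a F φ ψ).symm
    · exact hv.trans ((congrArg (F.v ≫ ·) e₁).trans (liftM_v F φ ψ).symm)
  apply hom_ext _ e₁
  apply (canonFst P Q).pb.hom_ext
  · exact h₀.trans (liftA_a₀ F φ ψ).symm
  · exact hu.trans ((congrArg (F.u ≫ ·) em).trans (liftA_u F φ ψ).symm)


/-- The first part of an induced morphism. -/
noncomputable def liftFst : F.fst ⟶ (canon P Q).fst where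
  f₀ := (liftA F φ ψ :)
  f₁ := (liftM F φ ψ :)
  w₁ := (assoc _ _ _).symm.trans ((congrArg (· ≫ P.p₁) (liftA_a₀ F φ ψ)).trans φ.w₁)
  w₃ := (assoc _ _ _).symm.trans ((congrArg (· ≫ P.p₃) (liftM_b F φ ψ)).trans φ.w₃)
  pb := (liftA_pb F φ ψ :)

/-- The second part of an induced morphism. -/
noncomputable def liftSnd : F.snd ⟶ (canon P Q).snd where
  f₀ := (liftM F φ ψ :)
  f₁ := (liftB F φ ψ :)
  w₁ := (assoc _ _ _).symm.trans ((congrArg (· ≫ P.p₃) (liftM_b F φ ψ)).trans φ.w₃)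
  w₃ := (assoc _ _ _).symm.trans ((congrArg (· ≫ Q.p₃) (liftB_c F φ ψ)).trans ψ.w₃)
  pb := (liftM_pb F φ ψ :)

theorem liftFst_canonFst : liftFst F φ ψ ≫ canonFst P Q = φ :=
  hom_ext (liftA_a₀ F φ ψ) (liftM_b F φ ψ)

theorem liftSnd_canonSnd : liftSnd F φ ψ ≫ canonSnd P Q = ψ :=
  hom_ext (liftM_a F φ ψ) (liftB_c F φ ψ)

variable {F φ ψ} {W' : Poly X Z} {F' : Fact W' Y}

theorem comp_lift (g : W' ⟶ W) (g₁ : F'.fst ⟶ F.fst) (g₂ : F'.snd ⟶ F.snd)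
    (h₀ : g₁.f₀ = g.f₀) (h₁ : g₂.f₁ = g.f₁) (hm : g₁.f₁ = g₂.f₀) :
    g ≫ lift F φ ψ = lift F' (g₁ ≫ φ) (g₂ ≫ ψ) := by
  apply eq_lift _ _ _ _ (g₁.f₁ ≫ liftM F φ ψ)
  · rw [comp_f₀, comp_f₀, assoc, h₀]
    exact congrArg (g.f₀ ≫ ·) (liftA_a₀ F φ ψ)
  · rw [comp_f₀, assoc, ← assoc F'.u, ← h₀]
    refine (congrArg (g₁.f₀ ≫ ·) (liftA_u F φ ψ)).trans ?_
    refine (assoc _ _ _).symm.trans ((congrArg (· ≫ liftM F φ ψ) g₁.pb.w))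
  · rw [assoc, liftM_b, comp_f₁]
  · rw [assoc, liftM_a, comp_f₀, hm]
  · rw [assoc, liftM_v, comp_f₁, hm, ← h₁, ← assoc, ← assoc]
    exact congrArg (· ≫ _) g₂.pb.w
  · rw [comp_f₁, comp_f₁, assoc, h₁]
    exact congrArg (g.f₁ ≫ ·) (liftB_c F φ ψ)

theorem lift_congr (g₁ : F'.fst ⟶ F.fst) (g₂ : F'.snd ⟶ F.snd) {W₀ : W' ⟶ W}
    (h₀ : g₁.f₀ = W₀.f₀) (h₁ : g₂.f₁ = W₀.f₁) (hm : g₁.f₁ = g₂.f₀)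
    {φ' : F'.fst ⟶ P} {ψ' : F'.snd ⟶ Q} (hφ : g₁ ≫ φ = φ') (hψ : g₂ ≫ ψ = ψ') :
    lift F' φ' ψ' = W₀ ≫ lift F φ ψ := by
  rw [comp_lift W₀ g₁ g₂ h₀ h₁ hm, hφ, hψ]

theorem lift_canon : lift (canon P Q) (canonFst P Q) (canonSnd P Q) = 𝟙 (comp P Q) :=
  (eq_lift _ _ _ (𝟙 (comp P Q)) (𝟙 _) (id_comp _) ((id_comp _).trans (comp_id _).symm)
    (id_comp _) (id_comp _) ((id_comp _).trans (comp_id _).symm) (id_comp _)).symm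

theorem exists_of_comp_lift {g : W' ⟶ W} {φ' : F'.fst ⟶ P} {ψ' : F'.snd ⟶ Q}
    (h : g ≫ lift F φ ψ = lift F' φ' ψ') :
    ∃ (g₁ : F'.fst ⟶ F.fst) (g₂ : F'.snd ⟶ F.snd), g₁.f₀ = g.f₀ ∧ g₂.f₁ = g.f₁ ∧
      g₁.f₁ = g₂.f₀ ∧ g₁ ≫ φ = φ' ∧ g₂ ≫ ψ = ψ' := by
  have hA : g.f₀ ≫ liftA F φ ψ = liftA F' φ' ψ' := congrArg Hom.f₀ h
  have hB : g.f₁ ≫ liftB F φ ψ = liftB F' φ' ψ' := congrArg Hom.f₁ h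
  let m : F'.M ⟶ F.M := (liftM_pb F φ ψ).lift (liftM F' φ' ψ') (F'.v ≫ g.f₁)
    (by rw [liftM_v, assoc, hB])
  have m₁ : m ≫ liftM F φ ψ = liftM F' φ' ψ' := (liftM_pb F φ ψ).lift_fst _ _ _
  have m₂ : m ≫ F.v = F'.v ≫ g.f₁ := (liftM_pb F φ ψ).lift_snd _ _ _
  have mu : g.f₀ ≫ F.u = F'.u ≫ m := by
    apply (liftM_pb F φ ψ).hom_ext
    · rw [assoc, assoc, m₁, ← liftA_u, ← liftA_u, ← assoc, hA]
    · rw [assoc, assoc, m₂, F.fac, g.pb.w, ← assoc, F'.fac]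
  have pbu : IsPullback g.f₀ F'.u F.u m := by
    refine IsPullback.of_right ?_ mu (liftA_pb F φ ψ)
    rw [hA, m₁]
    exact liftA_pb F' φ' ψ'
  have pbv : IsPullback m F'.v F.v g.f₁ := by
    refine IsPullback.of_right ?_ m₂ (liftM_pb F φ ψ)
    rw [hB, m₁]
    exact liftM_pb F' φ' ψ'
  have ey : m ≫ F.y = F'.y := by
    have e : φ.f₁ ≫ P.p₃ = F.y := φ.w₃
    have e' : φ'.f₁ ≫ P.p₃ = F'.y := φ'.w₃
    rw [← e, ← e', ← liftM_b F φ ψ, ← liftM_b F' φ' ψ', ← m₁, assoc, assoc, assoc]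
  refine ⟨⟨g.f₀, m, g.w₁, ey, pbu⟩, ⟨m, g.f₁, ey, g.w₃, pbv⟩, rfl, rfl, rfl, ?_, ?_⟩
  · apply hom_ext
    · rw [comp_f₀, ← liftA_a₀ F φ ψ, ← liftA_a₀ F' φ' ψ', ← hA, assoc]
    · rw [comp_f₁, ← liftM_b F φ ψ, ← liftM_b F' φ' ψ', ← m₁, assoc]
  · apply hom_ext
    · rw [comp_f₀, ← liftM_a F φ ψ, ← liftM_a F' φ' ψ', ← m₁, assoc]
    · rw [comp_f₁, ← liftB_c F φ ψ, ← liftB_c F' φ' ψ', ← hB, assoc]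

section Restrict
variable (θ : W ⟶ comp P Q)

/-- The factorisation obtained by pulling back the canonical one along a morphism. -/
noncomputable abbrev res : Fact W Y where
  M := pullback (canon P Q).v θ.f₁
  u := pullback.lift (f := (canon P Q).v) (g := θ.f₁) (θ.f₀ ≫ (canon P Q).u) W.p₂
    (by rw [assoc]; exact θ.pb.w)
  v := pullback.snd (canon P Q).v θ.f₁
  y := pullback.fst (canon P Q).v θ.f₁ ≫ (canon P Q).y
  hu := by
    refine exponentiable_of_isPullback (h := θ.f₀) (f := (canon P Q).u)
      (k := pullback.fst (canon P Q).v θ.f₁) ?_ (canon P Q).hu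
    refine IsPullback.of_bot (v₂₁ := pullback.snd (canon P Q).v θ.f₁) ?_
      (pullback.lift_fst _ _ _).symm (IsPullback.of_hasPullback (canon P Q).v θ.f₁)
    rw [pullback.lift_snd]
    exact θ.pb
  hv := exponentiable_of_isPullback (IsPullback.of_hasPullback _ _) (canon P Q).hv
  fac := pullback.lift_snd _ _ _

/-- The first part of the comparison of a pulled back factorisation with the canonical one. -/
noncomputable def resFst : (res θ).fst ⟶ (canon P Q).fst where
  f₀ := θ.f₀
  f₁ := pullback.fst (canon P Q).v θ.f₁
  w₁ := θ.w₁
  w₃ := rfl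
  pb := by
    refine IsPullback.of_bot (v₂₁ := pullback.snd (canon P Q).v θ.f₁) ?_
      (pullback.lift_fst _ _ _).symm (IsPullback.of_hasPullback (canon P Q).v θ.f₁)
    rw [pullback.lift_snd]
    exact θ.pb

/-- The second part of the comparison of a pulled back factorisation with the canonical one. -/
noncomputable def resSnd : (res θ).snd ⟶ (canon P Q).snd where
  f₀ := pullback.fst (canon P Q).v θ.f₁
  f₁ := θ.f₁
  w₁ := rfl
  w₃ := θ.w₃
  pb := IsPullback.of_hasPullback _ _

theorem lift_res : lift (res θ) (resFst θ ≫ canonFst P Q) (resSnd θ ≫ canonSnd P Q) = θ := by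
  rw [← comp_lift θ (resFst θ) (resSnd θ) rfl rfl rfl, lift_canon, comp_id]

end Restrict

/-- Horizontal composition of cartesian morphisms, induced by the universal property of the
composite. -/
noncomputable def hmap {P' : Poly X Y} {Q' : Poly Y Z} (η : P ⟶ P') (θ : Q ⟶ Q') :
    comp P Q ⟶ comp P' Q' :=
  lift (canon P Q) (canonFst P Q ≫ η) (canonSnd P Q ≫ θ)

theorem lift_hmap {P' : Poly X Y} {Q' : Poly Y Z} (η : P ⟶ P') (θ : Q ⟶ Q') :
    lift F φ ψ ≫ hmap η θ = lift F (φ ≫ η) (ψ ≫ θ) := by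
  rw [hmap, comp_lift (lift F φ ψ) (liftFst F φ ψ) (liftSnd F φ ψ) rfl rfl rfl, ← assoc,
    liftFst_canonFst, ← assoc, liftSnd_canonSnd]

theorem hmap_id : hmap (𝟙 P) (𝟙 Q) = 𝟙 (comp P Q) := by
  rw [hmap, comp_id, comp_id, lift_canon]

theorem hmap_comp {P' P'' : Poly X Y} {Q' Q'' : Poly Y Z} (η : P ⟶ P') (η' : P' ⟶ P'')
    (θ : Q ⟶ Q') (θ' : Q' ⟶ Q'') : hmap (η ≫ η') (θ ≫ θ') = hmap η θ ≫ hmap η' θ' := by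
  rw [hmap, hmap, lift_hmap, assoc, assoc]

end Lift

section Assoc
variable {X Y Z T : E}

/-- Rebracketing a composite of three maps from the left to the right: the outer factorisation. -/
abbrev assoc₁ {W : Poly X T} (F : Fact W Z) (G : Fact F.fst Y) : Fact W Y :=
  ⟨G.u, G.v ≫ F.v, G.y, G.hu, exponentiable_comp _ _ G.hv F.hv,
    (assoc _ _ _).symm.trans ((congrArg (· ≫ F.v) G.fac).trans F.fac)⟩

/-- Rebracketing from the left to the right: the factorisation of the second part. -/
abbrev assoc₂ {W : Poly X T} (F : Fact W Z) (G : Fact F.fst Y) : Fact (assoc₁ F G).snd Z :=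
  ⟨G.v, F.v, F.y, G.hv, F.hv, rfl⟩

/-- Rebracketing from the right to the left: the outer factorisation. -/
abbrev assoc₃ {W : Poly X T} (F : Fact W Y) (G : Fact F.snd Z) : Fact W Z :=
  ⟨F.u ≫ G.u, G.v, G.y, exponentiable_comp _ _ F.hu G.hu, G.hv,
    (assoc _ _ _).trans ((congrArg (F.u ≫ ·) G.fac).trans F.fac)⟩

/-- Rebracketing from the right to the left: the factorisation of the first part. -/
abbrev assoc₄ {W : Poly X T} (F : Fact W Y) (G : Fact F.snd Z) : Fact (assoc₃ F G).fst Y :=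
  ⟨F.u, G.u, F.y, F.hu, G.hu, rfl⟩

variable {P : Poly X Y} {Q : Poly Y Z} {R : Poly Z T}

variable (P Q R) in
/-- The associativity morphism `R ∘ (Q ∘ P) ⟶ (R ∘ Q) ∘ P`. -/
noncomputable def assocHom : comp (comp P Q) R ⟶ comp P (comp Q R) :=
  lift (assoc₁ (canon (comp P Q) R) (res (canonFst (comp P Q) R)))
    (resFst (canonFst (comp P Q) R) ≫ canonFst P Q)
    (lift (assoc₂ (canon (comp P Q) R) (res (canonFst (comp P Q) R)))
      (resSnd (canonFst (comp P Q) R) ≫ canonSnd P Q) (canonSnd (comp P Q) R))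

variable (P Q R) in
/-- The inverse associativity morphism. -/
noncomputable def assocInv : comp P (comp Q R) ⟶ comp (comp P Q) R :=
  lift (assoc₃ (canon P (comp Q R)) (res (canonSnd P (comp Q R))))
    (lift (assoc₄ (canon P (comp Q R)) (res (canonSnd P (comp Q R))))
      (canonFst P (comp Q R)) (resFst (canonSnd P (comp Q R)) ≫ canonFst Q R))
    (resSnd (canonSnd P (comp Q R)) ≫ canonSnd Q R)

theorem lift_assocHom {W : Poly X T} (F : Fact W Z) (G : Fact F.fst Y) (φ₁ : G.fst ⟶ P)
    (φ₂ : G.snd ⟶ Q) (ρ : F.snd ⟶ R) :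
    lift F (lift G φ₁ φ₂) ρ ≫ assocHom P Q R =
      lift (assoc₁ F G) φ₁ (lift (assoc₂ F G) φ₂ ρ) := by
  obtain ⟨g₁, g₂, h₀, h₁, hm, e₁, e₂⟩ := exists_of_comp_lift
    ((congrArg (liftFst F (lift G φ₁ φ₂) ρ ≫ ·) (lift_res (canonFst (comp P Q) R))).trans
      (liftFst_canonFst F (lift G φ₁ φ₂) ρ))
  let k₁ : (assoc₁ F G).fst ⟶
      (assoc₁ (canon (comp P Q) R) (res (canonFst (comp P Q) R))).fst := g₁
  let k₂ : (assoc₁ F G).snd ⟶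
      (assoc₁ (canon (comp P Q) R) (res (canonFst (comp P Q) R))).snd :=
    ⟨g₂.f₀, (lift F (lift G φ₁ φ₂) ρ).f₁, g₂.w₁, (lift F (lift G φ₁ φ₂) ρ).w₃, by
      have a := g₂.pb
      rw [h₁] at a
      exact a.paste_vert (liftSnd F (lift G φ₁ φ₂) ρ).pb⟩
  rw [assocHom, comp_lift (lift F (lift G φ₁ φ₂) ρ) k₁ k₂ h₀ rfl hm,
    comp_lift k₂ (F' := assoc₂ F G) g₂ (liftSnd F (lift G φ₁ φ₂) ρ) rfl rfl h₁,
    liftSnd_canonSnd]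
  rw [← e₁, ← e₂]

theorem lift_assocInv {W : Poly X T} (F : Fact W Y) (G : Fact F.snd Z) (φ : F.fst ⟶ P)
    (ψ₁ : G.fst ⟶ Q) (ψ₂ : G.snd ⟶ R) :
    lift F φ (lift G ψ₁ ψ₂) ≫ assocInv P Q R =
      lift (assoc₃ F G) (lift (assoc₄ F G) φ ψ₁) ψ₂ := by
  obtain ⟨g₁, g₂, h₀, h₁, hm, e₁, e₂⟩ := exists_of_comp_lift
    ((congrArg (liftSnd F φ (lift G ψ₁ ψ₂) ≫ ·) (lift_res (canonSnd P (comp Q R)))).trans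
      (liftSnd_canonSnd F φ (lift G ψ₁ ψ₂)))
  let k₁ : (assoc₃ F G).fst ⟶
      (assoc₃ (canon P (comp Q R)) (res (canonSnd P (comp Q R)))).fst :=
    ⟨(lift F φ (lift G ψ₁ ψ₂)).f₀, g₁.f₁, (lift F φ (lift G ψ₁ ψ₂)).w₁, g₁.w₃, by
      have a := g₁.pb
      rw [h₀] at a
      exact (liftFst F φ (lift G ψ₁ ψ₂)).pb.paste_vert a⟩
  let k₂ : (assoc₃ F G).snd ⟶
      (assoc₃ (canon P (comp Q R)) (res (canonSnd P (comp Q R)))).snd := g₂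
  rw [assocInv, comp_lift (lift F φ (lift G ψ₁ ψ₂)) k₁ k₂ rfl h₁ hm,
    comp_lift k₁ (F' := assoc₄ F G) (liftFst F φ (lift G ψ₁ ψ₂)) g₁ rfl rfl h₀.symm,
    liftFst_canonFst]
  rw [← e₁, ← e₂]

theorem lift_assoc₃₁ {W : Poly X T} (F : Fact W Z) (G : Fact F.fst Y) (φ₁ : G.fst ⟶ P)
    (φ₂ : G.snd ⟶ Q) (ρ : F.snd ⟶ R) :
    lift (assoc₃ (assoc₁ F G) (assoc₂ F G)) (lift (assoc₄ (assoc₁ F G) (assoc₂ F G)) φ₁ φ₂) ρ =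
      lift F (lift G φ₁ φ₂) ρ := by
  let g : (assoc₃ (assoc₁ F G) (assoc₂ F G)).fst ⟶ F.fst :=
    ⟨𝟙 _, 𝟙 _, id_comp _, id_comp _, IsPullback.of_horiz_isIso
      ⟨(id_comp _).trans (G.fac.symm.trans (comp_id _).symm)⟩⟩
  refine (lift_congr (F := F) (F' := assoc₃ (assoc₁ F G) (assoc₂ F G)) (W₀ := 𝟙 W)
    g (𝟙 F.snd) rfl rfl rfl (φ := lift G φ₁ φ₂) (ψ := ρ) ?_ (id_comp _)).trans (id_comp _)
  rw [comp_lift (F' := assoc₄ (assoc₁ F G) (assoc₂ F G)) g (𝟙 G.fst) (𝟙 G.snd) rfl rfl rfl]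
  exact congrArg₂ _ (id_comp _) (id_comp _)

theorem lift_assoc₁₃ {W : Poly X T} (F : Fact W Y) (G : Fact F.snd Z) (φ : F.fst ⟶ P)
    (ψ₁ : G.fst ⟶ Q) (ψ₂ : G.snd ⟶ R) :
    lift (assoc₁ (assoc₃ F G) (assoc₄ F G)) φ (lift (assoc₂ (assoc₃ F G) (assoc₄ F G)) ψ₁ ψ₂) =
      lift F φ (lift G ψ₁ ψ₂) := by
  let g : (assoc₁ (assoc₃ F G) (assoc₄ F G)).snd ⟶ F.snd :=
    ⟨𝟙 _, 𝟙 _, id_comp _, id_comp _, IsPullback.of_horiz_isIso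
      ⟨(id_comp _).trans (G.fac.symm.trans (comp_id _).symm)⟩⟩
  refine (lift_congr (F := F) (F' := assoc₁ (assoc₃ F G) (assoc₄ F G)) (W₀ := 𝟙 W)
    (𝟙 F.fst) g rfl rfl rfl (φ := φ) (ψ := lift G ψ₁ ψ₂) (id_comp _) ?_).trans (id_comp _)
  rw [comp_lift (F' := assoc₂ (assoc₃ F G) (assoc₄ F G)) g (𝟙 G.fst) (𝟙 G.snd) rfl rfl rfl]
  exact congrArg₂ _ (id_comp _) (id_comp _)

theorem assocHom_inv : assocHom P Q R ≫ assocInv P Q R = 𝟙 _ := by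
  rw [assocHom, lift_assocInv, lift_assoc₃₁, lift_res, lift_canon]

theorem assocInv_hom : assocInv P Q R ≫ assocHom P Q R = 𝟙 _ := by
  rw [assocInv, lift_assocHom, lift_assoc₁₃, lift_res, lift_canon]

variable (P Q R) in
/-- The associativity isomorphism `R ∘ (Q ∘ P) ≅ (R ∘ Q) ∘ P`. -/
noncomputable def associator : comp (comp P Q) R ≅ comp P (comp Q R) :=
  ⟨assocHom P Q R, assocInv P Q R, assocHom_inv, assocInv_hom⟩

theorem assocHom_natural {P' : Poly X Y} {Q' : Poly Y Z} {R' : Poly Z T} (η : P ⟶ P')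
    (θ : Q ⟶ Q') (κ : R ⟶ R') :
    hmap (hmap η θ) κ ≫ assocHom P' Q' R' = assocHom P Q R ≫ hmap η (hmap θ κ) := by
  have key {W : Poly X T} (F : Fact W Z) (G : Fact F.fst Y) (a : G.fst ⟶ P) (b : G.snd ⟶ Q)
      (c : F.snd ⟶ R) : lift F (lift G a b) c ≫ hmap (hmap η θ) κ ≫ assocHom P' Q' R' =
        lift F (lift G a b) c ≫ assocHom P Q R ≫ hmap η (hmap θ κ) := by
    rw [← assoc, lift_hmap, lift_hmap, lift_assocHom, ← assoc, lift_assocHom, lift_hmap, lift_hmap]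
  have := key (canon (comp P Q) R) (res (canonFst _ R))
    (resFst (canonFst _ R) ≫ canonFst P Q) (resSnd (canonFst _ R) ≫ canonSnd P Q) (canonSnd _ R)
  rwa [lift_res, lift_canon, id_comp, id_comp] at this

theorem pentagon {V : E} (S : Poly T V) :
    hmap (assocHom P Q R) (𝟙 S) ≫ assocHom P (comp Q R) S ≫ hmap (𝟙 P) (assocHom Q R S) =
      assocHom (comp P Q) R S ≫ assocHom P Q (comp R S) := by
  have key {W : Poly X V} (F : Fact W T) (G : Fact F.fst Z) (H : Fact G.fst Y) (a : H.fst ⟶ P)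
      (b : H.snd ⟶ Q) (c : G.snd ⟶ R) (d : F.snd ⟶ S) :
      lift F (lift G (lift H a b) c) d ≫ hmap (assocHom P Q R) (𝟙 S) ≫
        assocHom P (comp Q R) S ≫ hmap (𝟙 P) (assocHom Q R S) =
      lift F (lift G (lift H a b) c) d ≫ assocHom (comp P Q) R S ≫ assocHom P Q (comp R S) := by
    rw [← assoc, lift_hmap, ← assoc, lift_assocHom, comp_id, lift_assocHom, lift_hmap, comp_id,
      lift_assocHom, ← assoc, lift_assocHom, lift_assocHom]
    let g : (assoc₁ F (assoc₁ G H)).snd ⟶ (assoc₁ (assoc₁ F G) H).snd :=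
      ⟨𝟙 _, 𝟙 _, id_comp _, id_comp _, IsPullback.of_horiz_isIso
        ⟨(id_comp _).trans ((assoc _ _ _).symm.trans (comp_id _).symm)⟩⟩
    refine (lift_congr (F := assoc₁ (assoc₁ F G) H) (F' := assoc₁ F (assoc₁ G H))
      (W₀ := 𝟙 W) (φ := a) (𝟙 H.fst) g rfl rfl rfl (id_comp _) ?_).trans (id_comp _)
    rw [comp_lift (F' := assoc₁ (assoc₂ F (assoc₁ G H)) (assoc₂ G H)) g (𝟙 H.snd)
      (𝟙 (assoc₁ F G).snd) rfl rfl rfl]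
    exact congrArg₂ _ (id_comp _) (id_comp _)
  let θ := resFst (canonFst (comp (comp P Q) R) S) ≫ canonFst (comp P Q) R
  have := key (canon (comp (comp P Q) R) S) (res (canonFst _ S)) (res θ)
    (resFst θ ≫ canonFst P Q) (resSnd θ ≫ canonSnd P Q)
    (resSnd (canonFst _ S) ≫ canonSnd (comp P Q) R) (canonSnd _ S)
  rwa [lift_res, lift_res, lift_canon, id_comp, id_comp] at this

end Assoc

section Unit
variable {X Y Z : E}

theorem hom_idPoly_ext {P : Poly X X} (f g : P ⟶ idPoly X) : f = g :=
  hom_ext ((comp_id (Y := X) f.f₀).symm.trans ((f.w₁.trans g.w₁.symm).trans (comp_id _)))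
    ((comp_id (Y := X) f.f₁).symm.trans ((f.w₃.trans g.w₃.symm).trans (comp_id _)))

theorem idPoly_sq {P : Poly X X} (f : P ⟶ idPoly X) : P.p₁ = P.p₂ ≫ P.p₃ := by
  have h : f.f₀ ≫ 𝟙 X = P.p₂ ≫ f.f₁ := f.pb.w
  exact (f.w₁.symm.trans h).trans
    (congrArg (P.p₂ ≫ ·) ((comp_id (Y := X) f.f₁).symm.trans f.w₃))

instance : IsIso (idPoly X).p₂ := inferInstanceAs (IsIso (𝟙 X))

theorem isIso_of_idPoly {P : Poly X X} (f : P ⟶ idPoly X) : IsIso P.p₂ :=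
  f.pb.isIso_snd_of_isIso

variable (P : Poly X Y)

/-- The left unit morphism `P ∘ 1 ⟶ P`. -/
noncomputable def leftHom : comp (idPoly X) P ⟶ P where
  f₀ := (canon (idPoly X) P).u ≫ (canonSnd (idPoly X) P).f₀
  f₁ := (canonSnd (idPoly X) P).f₁
  w₁ := (assoc _ _ _).trans ((congrArg (_ ≫ ·) (canonSnd (idPoly X) P).w₁).trans
    (idPoly_sq (canonFst (idPoly X) P)).symm)
  w₃ := rfl
  pb := by
    have h : IsIso (canon (idPoly X) P).u := isIso_of_idPoly (canonFst (idPoly X) P)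
    have a : IsPullback (canon (idPoly X) P).u (comp (idPoly X) P).p₂ (canon (idPoly X) P).v
      (𝟙 (comp (idPoly X) P).B) := IsPullback.of_horiz_isIso ⟨(comp_id _).symm⟩
    have b := a.paste_horiz (canonSnd (idPoly X) P).pb
    rw [id_comp] at b
    exact b

/-- The right unit morphism `1 ∘ P ⟶ P`. -/
noncomputable def rightHom : comp P (idPoly Y) ⟶ P where
  f₀ := (canonFst P (idPoly Y)).f₀
  f₁ := letI : IsIso (canon P (idPoly Y)).v := isIso_of_idPoly (canonSnd P (idPoly Y))
    inv (canon P (idPoly Y)).v ≫ (canonFst P (idPoly Y)).f₁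
  w₁ := rfl
  w₃ := by
    have : IsIso (canon P (idPoly Y)).v := isIso_of_idPoly (canonSnd P (idPoly Y))
    rw [assoc, IsIso.inv_comp_eq]
    exact idPoly_sq (canonSnd P (idPoly Y))
  pb := by
    have : IsIso (canon P (idPoly Y)).v := isIso_of_idPoly (canonSnd P (idPoly Y))
    have a : IsPullback (𝟙 (comp P (idPoly Y)).A) (comp P (idPoly Y)).p₂ (canon P (idPoly Y)).u
      (inv (canon P (idPoly Y)).v) := IsPullback.of_horiz_isIso ⟨(id_comp _).trans
        ((IsIso.eq_comp_inv _).mpr rfl)⟩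
    have b := a.paste_horiz (canonFst P (idPoly Y)).pb
    rw [id_comp] at b
    exact b

variable {P}

theorem lift_leftHom_f₀ {W : Poly X Y} (F : Fact W X) (φ : F.fst ⟶ idPoly X) (ψ : F.snd ⟶ P) :
    (lift F φ ψ ≫ leftHom P).f₀ = F.u ≫ ψ.f₀ :=
  (assoc _ _ _).symm.trans ((congrArg (· ≫ (canonSnd (idPoly X) P).f₀) (liftA_u F φ ψ)).trans
    ((assoc _ _ _).trans (congrArg (F.u ≫ ·) (liftM_a F φ ψ))))

theorem lift_leftHom_f₁ {W : Poly X Y} (F : Fact W X) (φ : F.fst ⟶ idPoly X) (ψ : F.snd ⟶ P) :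
    (lift F φ ψ ≫ leftHom P).f₁ = ψ.f₁ := liftB_c F φ ψ

theorem lift_rightHom_f₀ {W : Poly X Y} (F : Fact W Y) (φ : F.fst ⟶ P) (ψ : F.snd ⟶ idPoly Y) :
    (lift F φ ψ ≫ rightHom P).f₀ = φ.f₀ := liftA_a₀ F φ ψ

theorem lift_rightHom_f₁ {W : Poly X Y} (F : Fact W Y) (φ : F.fst ⟶ P) (ψ : F.snd ⟶ idPoly Y) :
    F.v ≫ (lift F φ ψ ≫ rightHom P).f₁ = φ.f₁ := by
  have : IsIso (canon P (idPoly Y)).v := isIso_of_idPoly (canonSnd P (idPoly Y))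
  have h : F.v ≫ liftB F φ ψ ≫ inv (canon P (idPoly Y)).v = liftM F φ ψ := by
    rw [← assoc, IsIso.comp_inv_eq]
    exact (liftM_v F φ ψ).symm
  refine Eq.trans ?_ ((congrArg (· ≫ (canonFst P (idPoly Y)).f₁) h).trans (liftM_b F φ ψ))
  exact (congrArg (F.v ≫ ·) (assoc _ _ _).symm).trans (assoc _ _ _).symm

variable (P)

/-- The factorisation of `P` through the identity of its source. -/
abbrev trivL : Fact P X := ⟨𝟙 P.A, P.p₂, P.p₁, exponentiable_id _, P.exp, id_comp _⟩

/-- The factorisation of `P` through the identity of its target. -/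
abbrev trivR : Fact P Y := ⟨P.p₂, 𝟙 P.B, P.p₃, P.exp, exponentiable_id _, comp_id _⟩

/-- The inverse of the left unit morphism. -/
noncomputable def leftInv : P ⟶ comp (idPoly X) P :=
  lift (trivL P)
    ⟨P.p₁, P.p₁, comp_id _, comp_id _, IsPullback.of_vert_isIso
      ⟨(comp_id _).trans (id_comp _).symm⟩⟩ (𝟙 P)

/-- The inverse of the right unit morphism. -/
noncomputable def rightInv : P ⟶ comp P (idPoly Y) :=
  lift (trivR P) (𝟙 P)
    ⟨P.p₃, P.p₃, comp_id _, comp_id _, IsPullback.of_vert_isIso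
      ⟨(comp_id _).trans (id_comp _).symm⟩⟩

/-- The left unit isomorphism `P ∘ 1 ≅ P`. -/
noncomputable def leftUnitor : comp (idPoly X) P ≅ P where
  hom := leftHom P
  inv := leftInv P
  hom_inv_id := by
    have h : IsIso (canon (idPoly X) P).u := isIso_of_idPoly (canonFst (idPoly X) P)
    let g₁ : (canon (idPoly X) P).fst ⟶ (trivL P).fst :=
      ⟨(leftHom P).f₀, (canonSnd (idPoly X) P).f₀, (leftHom P).w₁, (canonSnd (idPoly X) P).w₁,
        IsPullback.of_vert_isIso ⟨comp_id _⟩⟩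
    rw [leftInv, comp_lift (F' := canon (idPoly X) P) (leftHom P) g₁ (canonSnd (idPoly X) P)
      rfl rfl rfl]
    exact (congrArg₂ _ (hom_idPoly_ext _ _) (comp_id _)).trans lift_canon
  inv_hom_id := hom_ext ((lift_leftHom_f₀ _ _ _).trans (comp_id _)) (lift_leftHom_f₁ _ _ _)

/-- The right unit isomorphism `1 ∘ P ≅ P`. -/
noncomputable def rightUnitor : comp P (idPoly Y) ≅ P where
  hom := rightHom P
  inv := rightInv P
  hom_inv_id := by
    have h : IsIso (canon P (idPoly Y)).v := isIso_of_idPoly (canonSnd P (idPoly Y))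
    let g₂ : (canon P (idPoly Y)).snd ⟶ (trivR P).snd :=
      ⟨(canonFst P (idPoly Y)).f₁, (rightHom P).f₁, rfl, (rightHom P).w₃,
        IsPullback.of_vert_isIso ⟨(comp_id _).trans (IsIso.hom_inv_id_assoc _ _).symm⟩⟩
    rw [rightInv, comp_lift (F' := canon P (idPoly Y)) (rightHom P) (canonFst P (idPoly Y)) g₂
      rfl rfl rfl]
    exact (congrArg₂ _ (comp_id _) (hom_idPoly_ext _ _)).trans lift_canon
  inv_hom_id := hom_ext (lift_rightHom_f₀ _ _ _)
    ((id_comp _).symm.trans (lift_rightHom_f₁ (trivR P) _ _))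

variable {P}

theorem leftHom_natural {P' : Poly X Y} (η : P ⟶ P') :
    hmap (𝟙 (idPoly X)) η ≫ leftHom P' = leftHom P ≫ η :=
  hom_ext ((lift_leftHom_f₀ _ _ _).trans (assoc _ _ _).symm) (lift_leftHom_f₁ _ _ _)

theorem rightHom_natural {P' : Poly X Y} (η : P ⟶ P') :
    hmap η (𝟙 (idPoly Y)) ≫ rightHom P' = rightHom P ≫ η := by
  have h : IsIso (canon P (idPoly Y)).v := isIso_of_idPoly (canonSnd P (idPoly Y))
  refine hom_ext (lift_rightHom_f₀ _ _ _) ?_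
  rw [← cancel_epi (canon P (idPoly Y)).v]
  exact (lift_rightHom_f₁ _ _ _).trans ((congrArg (· ≫ η.f₁)
    (IsIso.hom_inv_id_assoc (canon P (idPoly Y)).v (canonFst P (idPoly Y)).f₁)).symm.trans
      (assoc _ _ _))

theorem triangle {Q : Poly Y Z} : assocHom P (idPoly Y) Q ≫ hmap (𝟙 P) (leftHom Q) =
    hmap (rightHom P) (𝟙 Q) := by
  have key {W : Poly X Z} (F : Fact W Y) (G : Fact F.fst Y) (a : G.fst ⟶ P)
      (b : G.snd ⟶ idPoly Y) (c : F.snd ⟶ Q) :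
      lift F (lift G a b) c ≫ assocHom P (idPoly Y) Q ≫ hmap (𝟙 P) (leftHom Q) =
        lift F (lift G a b) c ≫ hmap (rightHom P) (𝟙 Q) := by
    have h : IsIso G.v := isIso_of_idPoly b
    rw [lift_hmap, ← assoc, lift_assocHom, lift_hmap, comp_id, comp_id]
    have e : G.y = G.v ≫ F.y := idPoly_sq b
    let g₁ : (assoc₁ F G).fst ⟶ F.fst := ⟨𝟙 _, G.v, id_comp _, e.symm,
      IsPullback.of_horiz_isIso ⟨(id_comp _).trans G.fac.symm⟩⟩
    let g₂ : (assoc₁ F G).snd ⟶ F.snd := ⟨G.v, 𝟙 _, e.symm, id_comp _,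
      IsPullback.of_horiz_isIso ⟨(comp_id _).symm⟩⟩
    refine (lift_congr (F := F) (F' := assoc₁ F G) (W₀ := 𝟙 W) g₁ g₂ rfl rfl rfl
      (ψ := c) ?_ ?_).trans (id_comp _)
    · exact hom_ext ((id_comp _).trans (lift_rightHom_f₀ _ _ _)) (lift_rightHom_f₁ _ _ _)
    · exact hom_ext (lift_leftHom_f₀ (assoc₂ F G) b c).symm
        ((id_comp _).trans (lift_leftHom_f₁ (assoc₂ F G) b c).symm)
  have := key (canon (comp P (idPoly Y)) Q) (res (canonFst _ Q))
    (resFst (canonFst _ Q) ≫ canonFst P (idPoly Y)) (resSnd (canonFst _ Q) ≫ canonSnd P (idPoly Y))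
    (canonSnd _ Q)
  rwa [lift_res, lift_canon, id_comp, id_comp] at this

end Unit
end Poly

/-- The objects of `E`, as objects of the bicategory of polynomials. -/
structure PolyCat (E : Type u) where
  obj : E

/-- The bicategory of polynomials in `E` and cartesian morphisms. The composite `P ≫ Q` is the
polynomial `Q ∘ P`. -/
noncomputable instance : Bicategory (PolyCat E) where
  Hom X Y := Poly X.obj Y.obj
  id X := Poly.idPoly X.obj
  comp P Q := Poly.comp P Q
  homCategory X Y := inferInstanceAs (Category (Poly X.obj Y.obj))
  whiskerLeft P _ _ η := Poly.hmap (𝟙 P) η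
  whiskerRight η Q := Poly.hmap η (𝟙 Q)
  associator P Q R := Poly.associator P Q R
  leftUnitor P := Poly.leftUnitor P
  rightUnitor P := Poly.rightUnitor P
  whiskerLeft_id P Q := Poly.hmap_id
  whiskerLeft_comp P _ _ _ η θ := by
    rw [← Poly.hmap_comp, id_comp]
  id_whiskerLeft η := by
    rw [← assoc, Iso.eq_comp_inv]; exact Poly.leftHom_natural η
  comp_whiskerLeft P Q _ _ η := by
    rw [← assoc, Iso.eq_comp_inv, ← Poly.hmap_id]; exact Poly.assocHom_natural _ _ _
  id_whiskerRight P Q := Poly.hmap_id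
  comp_whiskerRight η θ Q := by
    rw [← Poly.hmap_comp, id_comp]
  whiskerRight_id η := by
    rw [← assoc, Iso.eq_comp_inv]; exact Poly.rightHom_natural η
  whiskerRight_comp η Q R := by
    rw [Iso.eq_inv_comp, ← Poly.hmap_id]; exact (Poly.assocHom_natural _ _ _).symm
  whisker_assoc P _ _ η R := by
    rw [← assoc, Iso.eq_comp_inv]; exact Poly.assocHom_natural _ _ _
  whisker_exchange η θ := by
    rw [← Poly.hmap_comp, ← Poly.hmap_comp, id_comp, id_comp, comp_id, comp_id]
  pentagon P Q R S := Poly.pentagon S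
  triangle P Q := Poly.triangle

section BeckChevalley
variable {A A' B B' : E} {f : A ⟶ A'} {h : A ⟶ B} {g : A' ⟶ B'} {k : B ⟶ B'}

/-- The identification of `Σ_k Σ_h` with `Σ_g Σ_f` for a commutative square. -/
def sigmaSquare (w : f ≫ g = h ≫ k) :
    Over.map f ⋙ Over.map g ≅ Over.map h ⋙ Over.map k :=
  (Over.mapComp f g).symm ≪≫ Over.mapCongr _ _ w ≪≫ Over.mapComp h k

/-- The left Beck–Chevalley cell of a commutative square: the mate of the identity
`Σ_g Σ_f = Σ_k Σ_h` under `Σ_h ⊣ Δ_h` and `Σ_g ⊣ Δ_g`. -/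
noncomputable def leftBC (w : f ≫ g = h ≫ k) :
    Over.pullback h ⋙ Over.map f ⟶ Over.map k ⋙ Over.pullback g :=
  (mateEquiv (Over.mapPullbackAdj h) (Over.mapPullbackAdj g)
    (TwoSquare.mk _ _ _ _ (sigmaSquare w).hom)).natTrans

theorem leftBC_app (w : f ≫ g = h ≫ k) (y : Over B) : ((leftBC w).app y).left =
    pullback.lift (f := y.hom ≫ k) (g := g) (pullback.fst y.hom h) (pullback.snd y.hom h ≫ f)
      (by rw [assoc, w, ← assoc, pullback.condition, assoc]) := by
  apply pullback.hom_ext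
  · simp [leftBC, sigmaSquare, pullback.lift_fst, pullback.lift_fst_assoc]
  · simp [leftBC, sigmaSquare, pullback.lift_snd]

/-- The left Beck–Chevalley cell of a pullback square is invertible. -/
theorem isIso_leftBC (sq : IsPullback f h g k) : IsIso (leftBC sq.w) := by
  have (y : Over B) : IsIso ((leftBC sq.w).app y) := by
    have pb : IsPullback (pullback.fst y.hom h) (pullback.snd y.hom h ≫ f) (y.hom ≫ k) g :=
      ((IsPullback.of_hasPullback y.hom h).flip.paste_horiz sq).flip
    have : IsIso ((Over.forget _).map ((leftBC sq.w).app y)) := by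
      change IsIso ((leftBC sq.w).app y).left
      rw [leftBC_app]
      exact inferInstanceAs (IsIso pb.isoPullback.hom)
    exact isIso_of_reflects_iso _ (Over.forget _)
  exact NatIso.isIso_of_isIso_app _

/-- The right Beck–Chevalley isomorphism `Δ_k Π_g ≅ Π_h Δ_f` of a pullback square, obtained from
the left Beck–Chevalley isomorphism by taking right adjoints. -/
noncomputable def rightBC (sq : IsPullback f h g k) [Exponentiable g] [Exponentiable h] :
    piFunctor g ⋙ Over.pullback k ≅ Over.pullback f ⋙ piFunctor h :=
  letI := isIso_leftBC sq
  conjugateIsoEquiv ((Over.mapPullbackAdj k).comp (piAdj g)) ((piAdj h).comp (Over.mapPullbackAdj f))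
    (asIso (leftBC sq.w))

end BeckChevalley

namespace Poly
variable {X Y : E} {P Q : Poly X Y} (f : P ⟶ Q)

/-- The isomorphism `Δ_{p₁} ≅ Δ_{f₀} Δ_{q₁}`, which corresponds to the identity
`Σ_{q₁} Σ_{f₀} = Σ_{p₁}` between left adjoints. -/
noncomputable def deltaIso : Over.pullback P.p₁ ≅ Over.pullback Q.p₁ ⋙ Over.pullback f.f₀ :=
  conjugateIsoEquiv (Over.mapPullbackAdj P.p₁)
    ((Over.mapPullbackAdj f.f₀).comp (Over.mapPullbackAdj Q.p₁))
    ((Over.mapComp f.f₀ Q.p₁).symm ≪≫ Over.mapCongr _ _ f.w₁)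

/-- The transformation `Σ_{p₃} Δ_{f₁} ⟶ Σ_{q₃}`: the mate of the identity
`Σ_{p₃} = Σ_{q₃} Σ_{f₁}` under `Σ_{f₁} ⊣ Δ_{f₁}`. -/
noncomputable def sigmaMate : Over.pullback f.f₁ ⋙ Over.map P.p₃ ⟶ Over.map Q.p₃ :=
  Functor.whiskerLeft (Over.pullback f.f₁)
      ((Over.mapCongr _ _ f.w₃.symm).hom ≫ (Over.mapComp f.f₁ Q.p₃).hom) ≫
    (Functor.associator _ _ _).inv ≫
    Functor.whiskerRight (Over.mapPullbackAdj f.f₁).counit (Over.map Q.p₃) ≫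
    (Functor.leftUnitor _).hom

/-- The transformation of polynomial functors associated with a cartesian morphism:
`Σ_{p₃} Π_{p₂} Δ_{p₁} ≅ Σ_{p₃} Π_{p₂} Δ_{f₀} Δ_{q₁} ≅ Σ_{p₃} Δ_{f₁} Π_{q₂} Δ_{q₁}
⟶ Σ_{q₃} Π_{q₂} Δ_{q₁}`. -/
noncomputable def functorMap : functor P ⟶ functor Q :=
  Functor.whiskerRight (deltaIso f).hom (piFunctor P.p₂ ⋙ Over.map P.p₃) ≫
    (Functor.associator _ _ _).hom ≫
    Functor.whiskerLeft (Over.pullback Q.p₁) ((Functor.associator _ _ _).inv ≫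
      Functor.whiskerRight (rightBC f.pb).inv (Over.map P.p₃) ≫
      (Functor.associator _ _ _).hom ≫
      Functor.whiskerLeft (piFunctor Q.p₂) (sigmaMate f))

/-- The polynomial `x• = (C ⟵ C ⟶ C ⟶ X)` with identities on the left and in the middle, for an
object `x : C ⟶ X` of `E/X`. -/
def lft (x : Over X) : Poly x.left X := ⟨𝟙 _, 𝟙 _, x.hom, exponentiable_id _⟩

/-- The right projection from polynomials to `E/Y`, sending `p` to `p₃` and `f` to `f₁`. -/
def rightProj (X Y : E) : Poly X Y ⥤ Over Y where
  obj P := Over.mk P.p₃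
  map f := Over.homMk f.f₁ f.w₃

/-- The right projection of the composite of `x•` with `P` is the value at `x` of the polynomial
functor of `P`. -/
theorem rightProj_comp_lft (P : Poly X Y) (x : Over X) :
    (rightProj _ _).obj (comp (lft x) P) = (functor P).obj x := rfl

end Poly

/-- The data of `P_E`: it sends `X` to `E/X`, `p` to `Σ_{p₃} Π_{p₂} Δ_{p₁}` and a cartesian morphism
to the induced transformation. -/
noncomputable def polyStruct (E : Type u) [Category.{v} E] [HasPullbacks E] :
    PrelaxFunctorStruct (PolyCat E) Cat.{v, max u v} where
  obj X := Cat.of (Over X.obj)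
  map P := (Poly.functor P).toCatHom
  map₂ f := (Poly.functorMap f).toCatHom₂

end PolyCart

/-! An object `x : C ⟶ X` of `E/X` is the right projection of the polynomial `x•`, and the value of
the polynomial functor of `p` at `x` is, by definition, the right projection of `p ∘ x•`. Evaluation
of polynomial functors is thus composition in the bicategory of polynomials, seen through its
right-hand ends. Each pseudofunctor axiom, at the component `x`, becomes the right projection of an
identity of 2-cells that already holds among polynomials, with `x•` in the innermost place:
naturality of associativity gives the two whiskering axioms, the pentagon gives the associativity
axiom, and the triangle and its companion for `1 ∘ (q ∘ p)` give the unit axioms.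

Two dictionary lemmas make this translation possible. `functor_map_rightProj` says that applying the
functor of `q` to the right projection of a 2-cell is whiskering with `q`.
`functorMap_app_rightProj` says that the transformation built from mates and Beck–Chevalley cells,
evaluated at the right projection of `p`, is the right projection of whiskering with `p`. The second
is where the abstract definition meets the concrete horizontal composite. Both sides are maps into
some `Π_q w`, so it suffices to compare the maps out of the pullback to which they correspond;
`PiClassifies` records this correspondence, and `comp_rightBC` and `comp_rightBC_inv` follow it
through the Beck–Chevalley isomorphism.

One point does not come from the bicategory: naturality in `x` of the coherence isomorphisms. A map
`x ⟶ x'` of `E/X` changes the left end of `x•`, so it is not a 2-cell. It still induces cartesian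
maps between the second parts of the canonical factorisations, which do not see the left end, and
`assocHom_f₁_natural` and `rightHom_f₁_natural` use these. -/

namespace PolyCart
variable {E : Type u} [Category.{v} E] [HasPullbacks E]

/-! ### Generalised elements of `Π_q w` and the maps they classify. -/

section PiClassifies
variable {A B : E} {q : A ⟶ B} [Exponentiable q] {w : Over A} {U M : E}

/-- The map `t : U ⟶ Π_q w` corresponds to `b : M ⟶ w`, where `M` is the pullback of `U` along `q`
with projections `v` and `a`. -/
def PiClassifies (t : U ⟶ ((piFunctor q).obj w).left) (v : M ⟶ U) (a : M ⟶ A)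
    (b : M ⟶ w.left) : Prop :=
  ∃ m : M ⟶ pullback ((piFunctor q).obj w).hom q,
    m ≫ pullback.fst _ _ = v ≫ t ∧ m ≫ pullback.snd _ _ = a ∧ m ≫ piEv q w = b

namespace PiClassifies
variable {t t' : U ⟶ ((piFunctor q).obj w).left} {v : M ⟶ U} {a : M ⟶ A} {b b' : M ⟶ w.left}

/-- Uniqueness in the adjunction `Δ_q ⊣ Π_q`. `PiClassifies` itself only asks for a cone `(v, a)`;
that the cone is a pullback matters only here and in `ofPiLift`, so the other rules can be applied
without checking it. -/
theorem hom_ext {c : U ⟶ B} (pb : IsPullback v a c q)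
    (hc : t ≫ ((piFunctor q).obj w).hom = c) (hc' : t' ≫ ((piFunctor q).obj w).hom = c)
    (h : PiClassifies t v a b) (h' : PiClassifies t' v a b) : t = t' := by
  obtain ⟨m, h₁, h₂, h₃⟩ := h
  obtain ⟨m', h₁', h₂', h₃'⟩ := h'
  exact pi_hom_ext pb hc hc' h₁ h₂ h₁' h₂' (h₃.trans h₃'.symm)

theorem unique (h : PiClassifies t v a b) (h' : PiClassifies t v a b') : b = b' := by
  obtain ⟨m, h₁, h₂, rfl⟩ := h
  obtain ⟨m', h₁', h₂', rfl⟩ := h'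
  rw [pullback.hom_ext (h₁.trans h₁'.symm) (h₂.trans h₂'.symm)]

theorem ev_hom (h : PiClassifies t v a b) : b ≫ w.hom = a := by
  obtain ⟨m, h₁, h₂, rfl⟩ := h
  rw [assoc, piEv_hom, h₂]

theorem ofExists (t : U ⟶ ((piFunctor q).obj w).left)
    (h : v ≫ t ≫ ((piFunctor q).obj w).hom = a ≫ q) : ∃ b, PiClassifies t v a b :=
  ⟨_, pullback.lift (v ≫ t) a (by rw [assoc, h]), pullback.lift_fst _ _ _,
    pullback.lift_snd _ _ _, rfl⟩

variable (q w) in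
theorem id : PiClassifies (𝟙 _) (pullback.fst ((piFunctor q).obj w).hom q)
    (pullback.snd _ _) (piEv q w) :=
  ⟨𝟙 _, (id_comp _).trans (comp_id _).symm, id_comp _, id_comp _⟩

/-- Naturality of the counit: acting on an element by `Π_q g` is composing the map it classifies
with `g`. -/
theorem comp_map {w' : Over A} (h : PiClassifies t v a b) (g : w ⟶ w') :
    PiClassifies (t ≫ ((piFunctor q).map g).left) v a (b ≫ g.left) := by
  obtain ⟨m, h₁, h₂, rfl⟩ := h
  refine ⟨m ≫ ((Over.pullback q).map ((piFunctor q).map g)).left, ?_, ?_, ?_⟩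
  · rw [assoc, ← assoc v, ← h₁, assoc]
    exact congrArg (m ≫ ·) (pullback.lift_fst _ _ _)
  · rw [assoc, ← h₂]
    exact congrArg (m ≫ ·) (pullback.lift_snd _ _ _)
  · rw [assoc, assoc]
    exact congrArg (fun z => m ≫ z.left) ((piAdj q).counit.naturality g)

theorem precomp (h : PiClassifies t v a b) {U' M' : E} {s : U' ⟶ U} {v' : M' ⟶ U'} {m' : M' ⟶ M}
    {a' : M' ⟶ A} {b' : M' ⟶ w.left} (e : m' ≫ v = v' ≫ s) (ea : m' ≫ a = a')
    (eb : m' ≫ b = b') : PiClassifies (s ≫ t) v' a' b' := by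
  obtain ⟨m, h₁, h₂, rfl⟩ := h
  exact ⟨m' ≫ m, by rw [assoc, h₁, ← assoc, e, assoc], by rw [assoc, h₂, ea], by rw [assoc, eb]⟩

theorem ofPiLift {c : U ⟶ B} (pb : IsPullback v a c q) (hb : b ≫ w.hom = a) :
    PiClassifies (piLift pb b hb) v a b := by
  have e : (v ≫ piLift pb b hb) ≫ ((piFunctor q).obj w).hom = a ≫ q := by
    rw [assoc, piLift_hom, pb.w]
  exact ⟨pullback.lift _ a e, pullback.lift_fst _ _ _, pullback.lift_snd _ _ _,
    piLift_ev pb b hb _ (pullback.lift_fst _ _ _) (pullback.lift_snd _ _ _)⟩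

end PiClassifies
end PiClassifies

/-! ### Beck–Chevalley cells in terms of classified maps. -/

section BeckChevalley
variable {A A' B B' : E} {f : A ⟶ A'} {h : A ⟶ B} {g : A' ⟶ B'} {k : B ⟶ B'}

theorem mapPullbackAdj_counit_left {X Y : E} (f : X ⟶ Y) (y : Over Y) :
    ((Over.mapPullbackAdj f).counit.app y).left = pullback.fst y.hom f := by
  simp

/-- `rightBC` is the conjugate of `leftBC`, hence determined by its compatibility with the counits
of the two composite adjunctions. Written out on underlying maps, this is a usable formula for
evaluating an element after the Beck–Chevalley isomorphism. -/
theorem rightBC_counit (sq : IsPullback f h g k) [Exponentiable g] [Exponentiable h]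
    (w : Over A') :
    ((Over.pullback h).map ((rightBC sq).hom.app w)).left ≫
        piEv h ((Over.pullback f).obj w) ≫ pullback.fst w.hom f =
      ((leftBC sq.w).app ((Over.pullback k).obj ((piFunctor g).obj w))).left ≫
        ((Over.pullback g).map ((Over.mapPullbackAdj k).counit.app ((piFunctor g).obj w))).left ≫
          piEv g w := by
  have key := conjugateEquiv_counit ((Over.mapPullbackAdj k).comp (piAdj g))
    ((piAdj h).comp (Over.mapPullbackAdj f)) (leftBC sq.w) w
  have key' := congrArg (fun z => z.left) key
  simp only [Adjunction.comp_counit_app, Over.comp_left, mapPullbackAdj_counit_left] at key'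
  exact key'

theorem deltaIso_left {X Y : E} {P Q : Poly X Y} (f : P ⟶ Q) (x : Over X) :
    ((Poly.deltaIso f).hom.app x).left ≫ pullback.fst _ _ ≫ pullback.fst _ _ =
      pullback.fst x.hom P.p₁ := by
  have key := conjugateEquiv_counit (Over.mapPullbackAdj P.p₁)
    ((Over.mapPullbackAdj f.f₀).comp (Over.mapPullbackAdj Q.p₁))
    ((Over.mapComp f.f₀ Q.p₁).symm ≪≫ Over.mapCongr _ _ f.w₁).hom x
  have key' := congrArg (fun z => z.left) key
  simp only [Adjunction.comp_counit_app, Over.comp_left, mapPullbackAdj_counit_left] at key'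
  refine (congrArg (fun z => ((Poly.deltaIso f).hom.app x).left ≫ z ≫ pullback.fst x.hom Q.p₁)
    (mapPullbackAdj_counit_left f.f₀ _).symm).trans (key'.trans ?_)
  simp

/-- By pasting with the pullback square, pulling back along `h` and then mapping by `f` agrees with
mapping by `k` and then pulling back along `g`. So the same `M` serves on both sides, and the
Beck–Chevalley map merely pairs the classified `b` with `a`. -/
theorem PiClassifies.comp_rightBC (sq : IsPullback f h g k) [Exponentiable g] [Exponentiable h]
    {w : Over A'} {U M : E} {v : M ⟶ U} {a : M ⟶ A} {b : M ⟶ w.left}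
    {s : U ⟶ pullback ((piFunctor g).obj w).hom k} (e : v ≫ s ≫ pullback.snd _ _ = a ≫ h)
    (H : PiClassifies (s ≫ pullback.fst _ _) v (a ≫ f) b) :
    PiClassifies (w := (Over.pullback f).obj w) (s ≫ ((rightBC sq).hom.app w).left) v a
      (pullback.lift b a H.ev_hom) := by
  obtain ⟨m, h₁, h₂, h₃⟩ := H
  let n : M ⟶ pullback (pullback.snd ((piFunctor g).obj w).hom k) h :=
    pullback.lift (v ≫ s) a (by rw [assoc, e])
  have n₁ : n ≫ pullback.fst _ _ = v ≫ s := pullback.lift_fst _ _ _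
  have n₂ : n ≫ pullback.snd _ _ = a := pullback.lift_snd _ _ _
  have e₂ : (n ≫ ((Over.pullback h).map ((rightBC sq).hom.app w)).left) ≫ pullback.snd _ _ = a := by
    rw [assoc, ← n₂]
    exact congrArg (n ≫ ·) (pullback.lift_snd _ _ _)
  refine ⟨n ≫ ((Over.pullback h).map ((rightBC sq).hom.app w)).left, ?_, e₂, ?_⟩
  · rw [assoc, ← assoc v, ← n₁, assoc]
    exact congrArg (n ≫ ·) (pullback.lift_fst _ _ _)
  · apply pullback.hom_ext
    · refine Eq.trans ?_ (pullback.lift_fst _ _ _).symm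
      rw [assoc, assoc]
      refine (congrArg (n ≫ ·) (rightBC_counit sq w)).trans ?_
      rw [← h₃, ← assoc, ← assoc]
      refine congrArg (· ≫ piEv g w) ?_
      -- With the evaluation at `w` cancelled, it remains to see that `n`, carried through `leftBC`
      -- and the counit, is the given `m`; both are maps into a pullback along `g`.
      apply pullback.hom_ext
      · refine Eq.trans ?_ h₁.symm
        rw [assoc, assoc]
        refine (congrArg (fun z => n ≫ _ ≫ z) (pullback.lift_fst _ _ _)).trans ?_
        rw [leftBC_app, mapPullbackAdj_counit_left, ← assoc v, ← n₁]
        refine Eq.trans ?_ (assoc _ _ _).symm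
        exact congrArg (n ≫ ·) (pullback.lift_fst_assoc _ _ _ _)
      · refine Eq.trans ?_ h₂.symm
        rw [assoc, assoc]
        refine (congrArg (fun z => n ≫ _ ≫ z) (pullback.lift_snd _ _ _)).trans ?_
        rw [leftBC_app, ← n₂]
        refine Eq.trans ?_ (assoc _ _ _).symm
        exact congrArg (n ≫ ·) (pullback.lift_snd _ _ _)
    · refine Eq.trans ?_ (pullback.lift_snd _ _ _).symm
      refine Eq.trans ?_ e₂
      rw [assoc, assoc, assoc]
      have := piEv_hom h ((Over.pullback f).obj w)
      exact congrArg (fun z => n ≫ _ ≫ z) this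

theorem PiClassifies.comp_rightBC_inv (sq : IsPullback f h g k) [Exponentiable g]
    [Exponentiable h] {w : Over A'} {U M : E} {v : M ⟶ U} {a : M ⟶ A} {b : M ⟶ pullback w.hom f}
    {t : U ⟶ ((piFunctor h).obj ((Over.pullback f).obj w)).left}
    (e : v ≫ t ≫ ((piFunctor h).obj ((Over.pullback f).obj w)).hom = a ≫ h)
    (H : PiClassifies t v a b) :
    PiClassifies (t ≫ ((rightBC sq).inv.app w).left ≫ pullback.fst _ _) v (a ≫ f)
      (b ≫ pullback.fst _ _) := by
  let s : U ⟶ pullback ((piFunctor g).obj w).hom k := t ≫ ((rightBC sq).inv.app w).left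
  have hs : s ≫ pullback.snd _ _ = t ≫ ((piFunctor h).obj ((Over.pullback f).obj w)).hom :=
    (assoc _ _ _).trans (congrArg (t ≫ ·) (Over.w ((rightBC sq).inv.app w)))
  have ht : s ≫ ((rightBC sq).hom.app w).left = t := by
    refine (assoc _ _ _).trans (Eq.trans ?_ (comp_id t))
    exact congrArg (fun z => t ≫ z.left) ((rightBC sq).inv_hom_id_app w)
  have e' : v ≫ s ≫ pullback.snd _ _ = a ≫ h := by rw [hs, e]
  -- The element obtained by applying the inverse classifies some `b'`. Going forward again by
  -- `comp_rightBC` returns `t`, so uniqueness of the classified map identifies `b'` with the first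
  -- projection of `b`.
  obtain ⟨b', H'⟩ := PiClassifies.ofExists (q := g) (w := w) (v := v) (a := a ≫ f)
    (s ≫ pullback.fst _ _) (by rw [assoc, pullback.condition, ← assoc s, ← assoc v, e', assoc,
      assoc, sq.w])
  have H'' := H'.comp_rightBC sq e'
  rw [ht] at H''
  rw [H.unique H'', pullback.lift_fst, ← assoc t]
  exact H'

end BeckChevalley

/-! ### Evaluation of polynomial functors as whiskering. -/

namespace Poly
variable {X Y Z T : E}

theorem piClassifies_liftB {P : Poly X Y} {Q : Poly Y Z} {W : Poly X Z} (F : Fact W Y)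
    (φ : F.fst ⟶ P) (ψ : F.snd ⟶ Q) :
    PiClassifies (q := Q.p₂) (w := (Over.pullback Q.p₁).obj (Over.mk P.p₃)) (liftB F φ ψ) F.v ψ.f₀
      (pullback.lift (f := P.p₃) (g := Q.p₁) φ.f₁ ψ.f₀ (φ.w₃.trans ψ.w₁.symm)) :=
  PiClassifies.ofPiLift ψ.pb.flip (pullback.lift_snd _ _ _)

/-- The form in which uniqueness is used. Only the component of `b` in `P.B` needs checking, because
`ev_hom` forces the other one to be `a`. -/
theorem eq_liftB {P : Poly X Y} {Q : Poly Y Z} {W : Poly X Z} (F : Fact W Y)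
    (φ : F.fst ⟶ P) (ψ : F.snd ⟶ Q) {t : W.B ⟶ (comp P Q).B}
    {a : F.M ⟶ Q.A} {b : F.M ⟶ pullback P.p₃ Q.p₁}
    (H : PiClassifies (q := Q.p₂) (w := (Over.pullback Q.p₁).obj (Over.mk P.p₃)) t F.v a b)
    (ha : a = ψ.f₀) (hc : t ≫ (compD P Q).hom = ψ.f₁) (hb : b ≫ pullback.fst _ _ = φ.f₁) : t = liftB F φ ψ := by
  have e : b = pullback.lift (f := P.p₃) (g := Q.p₁) φ.f₁ ψ.f₀ (φ.w₃.trans ψ.w₁.symm) := by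
    apply pullback.hom_ext
    · rw [hb, pullback.lift_fst]
    · subst ha
      exact H.ev_hom.trans (pullback.lift_snd _ _ _).symm
  subst e ha
  exact H.hom_ext ψ.pb.flip hc (liftB_c F φ ψ) (piClassifies_liftB F φ ψ)

/-- The identity of `Π` classifies the evaluation map, so `comp_map` computes what the left side
classifies, and this is the map that defines the horizontal composite. -/
theorem functor_map_rightProj {P P' : Poly X Y} (θ : P ⟶ P') (Q : Poly Y Z) :
    (functor Q).map ((rightProj X Y).map θ) = (rightProj X Z).map (hmap θ (𝟙 Q)) := by
  ext
  have H := (PiClassifies.id Q.p₂ ((Over.pullback Q.p₁).obj (Over.mk P.p₃))).comp_map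
    ((Over.pullback Q.p₁).map ((rightProj X Y).map θ))
  rw [id_comp] at H
  refine eq_liftB (canon P Q) (canonFst P Q ≫ θ) (canonSnd P Q ≫ 𝟙 Q) H
    (comp_id _).symm ?_ ?_
  · exact (Over.w ((piFunctor Q.p₂).map ((Over.pullback Q.p₁).map ((rightProj X Y).map θ)))).trans
      (comp_id _).symm
  · refine (assoc _ _ _).trans ((congrArg (_ ≫ ·) (pullback.lift_fst _ _ _)).trans ?_)
    exact (assoc _ _ _).symm

theorem sigmaMate_app_left {P Q : Poly X Y} (f : P ⟶ Q) (y : Over Q.B) :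
    ((sigmaMate f).app y).left = pullback.fst y.hom f.f₁ := by
  simp [sigmaMate]

theorem functorMap_app_left {P Q : Poly X Y} (f : P ⟶ Q) (x : Over X) :
    ((functorMap f).app x).left = ((piFunctor P.p₂).map ((deltaIso f).hom.app x)).left ≫
      ((rightBC f.pb).inv.app ((Over.pullback Q.p₁).obj x)).left ≫ pullback.fst _ _ := by
  -- The identities are the components of the functor associators.
  change _ ≫ 𝟙 _ ≫ 𝟙 _ ≫ _ ≫ 𝟙 _ ≫ ((sigmaMate f).app _).left = _
  rw [id_comp, id_comp, id_comp, sigmaMate_app_left]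
  rfl

/-- The generic element is followed through the three stages of the transformation. `comp_map`
handles the comparison of pullbacks, `comp_rightBC_inv` the Beck–Chevalley inverse, and the last
stage is a projection. An arbitrary `P` is allowed, not only `x•`, since whiskering on the left
evaluates at `p ∘ x•`. -/
theorem functorMap_app_rightProj (P : Poly X Y) {Q Q' : Poly Y Z} (f : Q ⟶ Q') :
    (functorMap f).app ((rightProj X Y).obj P) = (rightProj X Z).map (hmap (𝟙 P) f) := by
  ext
  rw [functorMap_app_left]
  have H := (PiClassifies.id Q.p₂ ((Over.pullback Q.p₁).obj (Over.mk P.p₃))).comp_map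
    ((deltaIso f).hom.app (Over.mk P.p₃))
  have e : ((piFunctor Q.p₂).map ((deltaIso f).hom.app (Over.mk P.p₃))).left ≫
      ((piFunctor Q.p₂).obj _).hom = (compD P Q).hom :=
    Over.w ((piFunctor Q.p₂).map ((deltaIso f).hom.app (Over.mk P.p₃)))
  rw [id_comp] at H
  have H' := H.comp_rightBC_inv f.pb ((congrArg (pullback.fst _ _ ≫ ·) e).trans
    pullback.condition)
  refine eq_liftB (canon P Q) (canonFst P Q ≫ 𝟙 P) (canonSnd P Q ≫ f) H' rfl
    ?_ ?_
  · refine ((assoc _ _ _).trans (congrArg (_ ≫ ·) (assoc _ _ _))).trans ?_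
    refine (congrArg (fun z => _ ≫ _ ≫ z) pullback.condition).trans ?_
    have e' := Over.w ((rightBC f.pb).inv.app ((Over.pullback Q'.p₁).obj (Over.mk P.p₃)))
    refine (congrArg (((piFunctor Q.p₂).map ((deltaIso f).hom.app (Over.mk P.p₃))).left ≫ ·)
      ((assoc _ _ _).symm.trans (congrArg (· ≫ f.f₁) e'))).trans ?_
    exact (assoc _ _ _).symm.trans (congrArg (· ≫ f.f₁) e)
  -- The comparison of pullbacks does not change the projection to `P.B`, so what remains is the
  -- evaluation that defines `compB`.
  · refine (assoc _ _ _).trans ((assoc _ _ _).trans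
      ((congrArg (_ ≫ ·) (deltaIso_left f (Over.mk P.p₃))).trans ?_))
    exact (comp_id _).symm

variable {X' : E}

/-! ### Naturality along maps of right projections whose left ends may differ. -/

section CanonMap
variable {P : Poly X Y} {P' : Poly X' Y}
  (g : (rightProj X Y).obj P ⟶ (rightProj X' Y).obj P') (Q : Poly Y Z)

/-- The map between the middle objects of two composites with `Q` induced by a map between right
projections. -/
noncomputable def compMMap : compM P Q ⟶ compM P' Q :=
  ((Over.pullback Q.p₂).map ((piFunctor Q.p₂).map ((Over.pullback Q.p₁).map g))).left

theorem compMMap_v : compMMap g Q ≫ (canon P' Q).v = (canon P Q).v ≫ ((functor Q).map g).left :=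
  pullback.lift_fst _ _ _

theorem compMMap_a : compMMap g Q ≫ (canonSnd P' Q).f₀ = (canonSnd P Q).f₀ :=
  pullback.lift_snd _ _ _

/-- This is naturality of the counit of `Δ ⊣ Π`, followed by the projection to `P'.B`. -/
theorem compMMap_b : compMMap g Q ≫ compB P' Q = compB P Q ≫ g.left := by
  have e : compMMap g Q ≫ piEv Q.p₂ ((Over.pullback Q.p₁).obj (Over.mk P'.p₃)) =
      piEv Q.p₂ ((Over.pullback Q.p₁).obj (Over.mk P.p₃)) ≫ ((Over.pullback Q.p₁).map g).left :=
    congrArg (fun z => z.left) ((piAdj Q.p₂).counit.naturality ((Over.pullback Q.p₁).map g))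
  refine (assoc _ _ _).symm.trans ((congrArg (· ≫ pullback.fst P'.p₃ Q.p₁) e).trans ?_)
  refine (assoc _ _ _).trans ((congrArg (_ ≫ ·) (pullback.lift_fst _ _ _)).trans ?_)
  exact (assoc _ _ _).symm

theorem functor_map_hom : ((functor Q).map g).left ≫ (canonSnd P' Q).f₁ = (canonSnd P Q).f₁ :=
  Over.w ((piFunctor Q.p₂).map ((Over.pullback Q.p₁).map g))

/-- The morphism between the second parts of the canonical factorisations of two composites with
`Q` induced by a map between right projections. -/
noncomputable def canonSndMap : (canon P Q).snd ⟶ (canon P' Q).snd where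
  f₀ := compMMap g Q
  f₁ := ((functor Q).map g).left
  w₁ := by
    have e : g.left ≫ P'.p₃ = P.p₃ := Over.w g
    exact (assoc _ _ _).symm.trans ((congrArg (· ≫ P'.p₃) (compMMap_b g Q)).trans
      ((assoc _ _ _).trans (congrArg (compB P Q ≫ ·) e)))
  w₃ := Over.w ((functor Q).map g)
  pb := by
    -- Pasting with the square of `canonSnd P' Q` gives the square of `canonSnd P Q`, and both are
    -- pullbacks.
    refine IsPullback.of_right ?_ (compMMap_v g Q) (canonSnd P' Q).pb
    have := (canonSnd P Q).pb
    rw [← compMMap_a g Q, ← functor_map_hom g Q] at this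
    exact this

theorem canonSndMap_canonSnd : canonSndMap g Q ≫ canonSnd P' Q = canonSnd P Q :=
  hom_ext (compMMap_a g Q) (functor_map_hom g Q)

variable (R : Poly Z T)

/-- The right projection of a composite of a polynomial with `Q`, as a functor of the right
projection of that polynomial. -/
noncomputable abbrev compRightMap :
    (rightProj X Z).obj (comp P Q) ⟶ (rightProj X' Z).obj (comp P' Q) :=
  (functor Q).map g

/-- The map between the middle objects of two threefold composites induced by a map between right
projections. -/
noncomputable def resMMap : (res (canonFst (comp P Q) R)).M ⟶ (res (canonFst (comp P' Q) R)).M :=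
  pullback.lift (f := (canon P' Q).v) (g := compB (comp P' Q) R)
    (pullback.fst (canon P Q).v (compB (comp P Q) R) ≫ compMMap g Q)
    (pullback.snd (canon P Q).v (compB (comp P Q) R) ≫ compMMap (compRightMap g Q) R) (by
      have e₁ := congrArg (pullback.fst (canon P Q).v (compB (comp P Q) R) ≫ ·) (compMMap_v g Q)
      have e₂ := congrArg (pullback.snd (canon P Q).v (compB (comp P Q) R) ≫ ·)
        (compMMap_b (compRightMap g Q) R)
      refine (assoc _ _ _).trans (e₁.trans (Eq.trans ?_ (e₂.symm.trans (assoc _ _ _).symm)))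
      exact (assoc _ _ _).symm.trans ((congrArg (· ≫ _) pullback.condition).trans (assoc _ _ _)))

theorem resMMap_fst : resMMap g Q R ≫ (resSnd (canonFst (comp P' Q) R)).f₀ =
    (resSnd (canonFst (comp P Q) R)).f₀ ≫ compMMap g Q := pullback.lift_fst _ _ _

theorem resMMap_snd : resMMap g Q R ≫ (res (canonFst (comp P' Q) R)).v =
    (res (canonFst (comp P Q) R)).v ≫ compMMap (compRightMap g Q) R := pullback.lift_snd _ _ _

/-- The morphism between the second parts of the pulled back factorisations induced by a map
between right projections. -/
noncomputable def resSndMap :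
    (res (canonFst (comp P Q) R)).snd ⟶ (res (canonFst (comp P' Q) R)).snd where
  f₀ := resMMap g Q R
  f₁ := compMMap (compRightMap g Q) R
  w₁ := (assoc _ _ _).symm.trans ((congrArg (· ≫ (canon P' Q).y) (resMMap_fst g Q R)).trans
    ((assoc _ _ _).trans (congrArg (_ ≫ ·) (canonSndMap g Q).w₁)))
  w₃ := (canonSndMap (compRightMap g Q) R).w₁
  pb := by
    -- The pasted square is also the square of `resSnd` for `P` followed by that of `canonSndMap g
    -- Q`, hence a pullback.
    refine IsPullback.of_right ?_ (resMMap_snd g Q R) (resSnd (canonFst (comp P' Q) R)).pb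
    have := (resSnd (canonFst (comp P Q) R)).pb.paste_horiz (canonSndMap g Q).pb
    rw [resMMap_fst]
    have e : compMMap (compRightMap g Q) R ≫ (resSnd (canonFst (comp P' Q) R)).f₁ =
      (resSnd (canonFst (comp P Q) R)).f₁ ≫ (canonSndMap g Q).f₁ :=
        compMMap_b (compRightMap g Q) R
    rw [e]
    exact this

theorem resSndMap_resSnd : resSndMap g Q R ≫ resSnd (canonFst (comp P' Q) R) =
    resSnd (canonFst (comp P Q) R) ≫ canonSndMap g Q :=
  hom_ext (resMMap_fst g Q R) (compMMap_b (compRightMap g Q) R)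

/-- Both sides map into a `Π` along the middle map of `R ∘ Q`, so it suffices that they classify the
same map. The second parts of the rebracketed factorisations are compared by the cartesian map `k`,
although no 2-cell `P ⟶ P'` is given, or even has a meaning when `X` and `X'` differ. -/
theorem assocHom_f₁_natural :
    ((functor R).map ((functor Q).map g)).left ≫ (assocHom P' Q R).f₁ =
      (assocHom P Q R).f₁ ≫ ((functor (comp Q R)).map g).left := by
  have hexp : Exponentiable (comp Q R).p₂ := (comp Q R).exp
  let F := canon (comp P Q) R
  let F' := canon (comp P' Q) R
  let G := res (canonFst (comp P Q) R)
  let G' := res (canonFst (comp P' Q) R)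
  let ψ : (assoc₁ F G).snd ⟶ comp Q R := lift (assoc₂ F G)
      (resSnd (canonFst (comp P Q) R) ≫ canonSnd P Q) (canonSnd (comp P Q) R)
  let ψ' : (assoc₁ F' G').snd ⟶ comp Q R := lift (assoc₂ F' G')
      (resSnd (canonFst (comp P' Q) R) ≫ canonSnd P' Q) (canonSnd (comp P' Q) R)
  let k : (assoc₁ F G).snd ⟶ (assoc₁ F' G').snd :=
    ⟨resMMap g Q R, ((functor R).map (compRightMap g Q)).left, (resSndMap g Q R).w₁,
      (canonSndMap (compRightMap g Q) R).w₃,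
      (resSndMap g Q R).pb.paste_vert (canonSndMap (compRightMap g Q) R).pb⟩
  have hk : k ≫ ψ' = ψ := by
    rw [comp_lift k (F' := assoc₂ F G) (resSndMap g Q R) (canonSndMap (compRightMap g Q) R)
      rfl rfl rfl, canonSndMap_canonSnd, ← assoc, resSndMap_resSnd, assoc, canonSndMap_canonSnd]
  let φ : (assoc₁ F G).fst ⟶ P := resFst (canonFst (comp P Q) R) ≫ canonFst P Q
  let φ' : (assoc₁ F' G').fst ⟶ P' := resFst (canonFst (comp P' Q) R) ≫ canonFst P' Q
  -- `H` describes the right side by postcomposition with the functor applied to `g`; `H'` describes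
  -- the left side by reindexing along `k`. The goal left by `H'` is that the two descriptions
  -- agree.
  have H := (piClassifies_liftB (assoc₁ F G) φ ψ).comp_map ((Over.pullback (comp Q R).p₁).map g)
  have H' := (piClassifies_liftB (assoc₁ F' G') φ' ψ').precomp
    (s := ((functor R).map (compRightMap g Q)).left) (m' := resMMap g Q R) (k.pb.w)
    (congrArg Hom.f₀ hk) (b' := pullback.lift (f := P.p₃) (g := (comp Q R).p₁) φ.f₁ ψ.f₀
      (φ.w₃.trans ψ.w₁.symm) ≫ ((Over.pullback (comp Q R).p₁).map g).left) ?_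
  · refine H'.hom_ext ψ.pb.flip ?_ ?_ H
    · exact (assoc _ _ _).trans ((congrArg (_ ≫ ·) (liftB_c (assoc₁ F' G') φ' ψ')).trans
        (congrArg Hom.f₁ hk))
    · exact (assoc _ _ _).trans ((congrArg (_ ≫ ·) (functor_map_hom g (comp Q R))).trans
        (liftB_c (assoc₁ F G) φ ψ))
  · apply pullback.hom_ext
    · refine (assoc _ _ _).trans ((congrArg (_ ≫ ·) (pullback.lift_fst _ _ _)).trans ?_)
      refine Eq.trans ?_ ((assoc _ _ _).trans ((congrArg (_ ≫ ·) (pullback.lift_fst _ _ _)).trans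
        ((assoc _ _ _).symm.trans (congrArg (· ≫ g.left) (pullback.lift_fst _ _ _))))).symm
      refine (assoc _ _ _).symm.trans ((congrArg (· ≫ compB P' Q) (resMMap_fst g Q R)).trans ?_)
      refine (assoc _ _ _).trans ((congrArg (_ ≫ ·) (compMMap_b g Q)).trans (assoc _ _ _).symm)
    · refine (assoc _ _ _).trans ((congrArg (_ ≫ ·) (pullback.lift_snd _ _ _)).trans ?_)
      refine Eq.trans (congrArg Hom.f₀ hk) ?_
      exact ((assoc _ _ _).trans ((congrArg (_ ≫ ·) (pullback.lift_snd _ _ _)).trans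
        (pullback.lift_snd _ _ _))).symm

/-- The middle map `v` of each canonical factorisation is invertible, being a pullback of an
identity. After cancelling it, `rightHom` becomes `compB`, and `compMMap_b` applies. -/
theorem rightHom_f₁_natural :
    ((functor (idPoly Y)).map g).left ≫ (rightHom P').f₁ = (rightHom P).f₁ ≫ g.left := by
  have h : IsIso (canon P (idPoly Y)).v := isIso_of_idPoly (canonSnd P (idPoly Y))
  have h' : IsIso (canon P' (idPoly Y)).v := isIso_of_idPoly (canonSnd P' (idPoly Y))
  have e : (canon P (idPoly Y)).v ≫ (rightHom P).f₁ = compB P (idPoly Y) :=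
    IsIso.hom_inv_id_assoc (canon P (idPoly Y)).v (canonFst P (idPoly Y)).f₁
  have e' : (canon P' (idPoly Y)).v ≫ (rightHom P').f₁ = compB P' (idPoly Y) :=
    IsIso.hom_inv_id_assoc (canon P' (idPoly Y)).v (canonFst P' (idPoly Y)).f₁
  refine (cancel_epi (canon P (idPoly Y)).v).mp ?_
  refine (assoc _ _ _).symm.trans ((congrArg (· ≫ _) (compMMap_v g (idPoly Y)).symm).trans ?_)
  refine (assoc _ _ _).trans ((congrArg (_ ≫ ·) e').trans ((compMMap_b g (idPoly Y)).trans ?_))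
  exact (congrArg (· ≫ g.left) e.symm).trans (assoc _ _ _)

end CanonMap

/-! ### Coherence isomorphisms and the pseudofunctor axioms, componentwise. -/

/-- The isomorphism of polynomial functors whose components are the right projections of
associativity isomorphisms. -/
noncomputable def functorComp (P : Poly X Y) (Q : Poly Y Z) :
    functor P ⋙ functor Q ≅ functor (comp P Q) :=
  NatIso.ofComponents (fun x => (rightProj x.left Z).mapIso (associator (lft x) P Q)) (by
    intro x x' g
    ext
    exact assocHom_f₁_natural (P := lft x) (P' := lft x') g P Q)

/-- The isomorphism between the polynomial functor of an identity and the identity functor whose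
components are the right projections of unit isomorphisms. -/
noncomputable def functorId (X : E) : functor (idPoly X) ≅ 𝟭 (Over X) :=
  NatIso.ofComponents (fun x => (rightProj x.left X).mapIso (rightUnitor (lft x))) (by
    intro x x' g
    ext
    exact rightHom_f₁_natural (P := lft x) (P' := lft x') g)

theorem functorMap_id (P : Poly X Y) : functorMap (𝟙 P) = 𝟙 (functor P) := by
  ext1
  funext x
  refine (functorMap_app_rightProj (lft x) (𝟙 P)).trans ?_
  rw [hmap_id]
  exact (rightProj _ _).map_id _

/-- Functoriality of whiskering with `x•` replaces any pasting of Beck–Chevalley cells. -/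
theorem functorMap_comp {P Q R : Poly X Y} (f : P ⟶ Q) (g : Q ⟶ R) :
    functorMap (f ≫ g) = functorMap f ≫ functorMap g := by
  ext1
  funext x
  refine (functorMap_app_rightProj (lft x) (f ≫ g)).trans ?_
  rw [← id_comp (𝟙 (lft x)), hmap_comp, Functor.map_comp]
  exact congrArg₂ (· ≫ ·) (functorMap_app_rightProj (lft x) f).symm
    (functorMap_app_rightProj (lft x) g).symm


theorem functorMap_whiskerLeft (P : Poly X Y) {Q Q' : Poly Y Z} (η : Q ⟶ Q') (x : Over X) :
    (functorMap (hmap (𝟙 P) η)).app x = (functorComp P Q).inv.app x ≫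
      (functorMap η).app ((functor P).obj x) ≫ (functorComp P Q').hom.app x := by
  refine (Iso.eq_inv_comp ((functorComp P Q).app x)).mpr ?_
  refine (congrArg (((functorComp P Q).app x).hom ≫ ·)
    (functorMap_app_rightProj (lft x) (hmap (𝟙 P) η))).trans ?_
  -- The object at which `η` is evaluated is by definition the right projection of `P ∘ x•`, so the
  -- dictionary lemma is used with that composite polynomial.
  refine Eq.trans ?_ (congrArg (· ≫ (functorComp P Q').hom.app x)
    (functorMap_app_rightProj (comp (lft x) P) η).symm)
  have := congrArg (rightProj x.left Z).map
    (assocHom_natural (𝟙 (lft x)) (𝟙 P) η)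
  rw [hmap_id, Functor.map_comp, Functor.map_comp] at this
  exact this.symm

theorem functorMap_whiskerRight {P P' : Poly X Y} (η : P ⟶ P') (Q : Poly Y Z) (x : Over X) :
    (functorMap (hmap η (𝟙 Q))).app x = (functorComp P Q).inv.app x ≫
      (functor Q).map ((functorMap η).app x) ≫ (functorComp P' Q).hom.app x := by
  refine (Iso.eq_inv_comp ((functorComp P Q).app x)).mpr ?_
  refine (congrArg (((functorComp P Q).app x).hom ≫ ·)
    (functorMap_app_rightProj (lft x) (hmap η (𝟙 Q)))).trans ?_
  refine Eq.trans ?_ (congrArg (· ≫ (functorComp P' Q).hom.app x)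
    ((congrArg (functor Q).map (functorMap_app_rightProj (lft x) η)).trans
      (functor_map_rightProj (hmap (𝟙 (lft x)) η) Q)).symm)
  have := congrArg (rightProj x.left Z).map (assocHom_natural (𝟙 (lft x)) η (𝟙 Q))
  rw [Functor.map_comp, Functor.map_comp] at this
  exact this.symm

/-- The right projection of the pentagon for `x•`, `P`, `Q`, `R`, with two of its isomorphisms moved
across. The whiskered sides of the pentagon are read by the two dictionary lemmas. -/
theorem functorMap_associator (P : Poly X Y) (Q : Poly Y Z) (R : Poly Z T) (x : Over X) :
    (functorMap (assocHom P Q R)).app x = (functorComp (comp P Q) R).inv.app x ≫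
      (functor R).map ((functorComp P Q).inv.app x) ≫
        (functorComp Q R).hom.app ((functor P).obj x) ≫ (functorComp P (comp Q R)).hom.app x := by
  refine (Iso.eq_inv_comp ((functorComp (comp P Q) R).app x)).mpr ?_
  refine (Iso.eq_inv_comp ((functor R).mapIso ((functorComp P Q).app x))).mpr ?_
  have := congrArg (rightProj x.left T).map (pentagon (P := lft x) (Q := P) (R := Q) R)
  rw [Functor.map_comp, Functor.map_comp, Functor.map_comp] at this
  refine Eq.trans ?_ this
  exact congrArg₂ (· ≫ ·) (functor_map_rightProj (assocHom (lft x) P Q) R)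
    (congrArg (_ ≫ ·) (functorMap_app_rightProj (lft x) (assocHom P Q R)))

/-- The right projection of the triangle for `x•`, the identity and `P`. -/
theorem functorMap_leftUnitor (P : Poly X Y) (x : Over X) :
    (functorMap (leftHom P)).app x = (functorComp (idPoly X) P).inv.app x ≫
      (functor P).map ((functorId X).hom.app x) := by
  refine (Iso.eq_inv_comp ((functorComp (idPoly X) P).app x)).mpr ?_
  have := congrArg (rightProj x.left Y).map (triangle (P := lft x) (Q := P))
  rw [Functor.map_comp] at this
  refine Eq.trans ?_ (this.trans (functor_map_rightProj (rightHom (lft x)) P).symm)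
  exact congrArg (_ ≫ ·) (functorMap_app_rightProj (lft x) (leftHom P))

/-- The other unit triangle is not an axiom but follows from the axioms in any bicategory; it is
read off from the bicategory of polynomials. -/
theorem assocHom_rightHom (P : Poly X Y) (Q : Poly Y Z) :
    assocHom P Q (idPoly Z) ≫ hmap (𝟙 P) (rightHom Q) = rightHom (comp P Q) := by
  have := (Bicategory.rightUnitor_comp (B := PolyCat E) (a := ⟨X⟩) (b := ⟨Y⟩) (c := ⟨Z⟩) P Q).symm
  exact this

theorem functorMap_rightUnitor (P : Poly X Y) (x : Over X) :
    (functorMap (rightHom P)).app x = (functorComp P (idPoly Y)).inv.app x ≫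
      (functorId Y).hom.app ((functor P).obj x) := by
  refine (Iso.eq_inv_comp ((functorComp P (idPoly Y)).app x)).mpr ?_
  have := congrArg (rightProj x.left Y).map (assocHom_rightHom (lft x) P)
  rw [Functor.map_comp] at this
  refine Eq.trans ?_ this
  exact congrArg (_ ≫ ·) (functorMap_app_rightProj (lft x) (rightHom P))

end Poly

/-! ### Assembly of the pseudofunctor. -/

/-- The homomorphism of bicategories which sends `X` to `E/X` and a polynomial to its polynomial
functor. -/
noncomputable def polyPseudofunctor (E : Type u) [Category.{v} E] [HasPullbacks E] :
    Pseudofunctor (PolyCat E) Cat.{v, max u v} where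
  toPrelaxFunctorStruct := polyStruct E
  map₂_id P := congrArg NatTrans.toCatHom₂ (Poly.functorMap_id P)
  map₂_comp f g := congrArg NatTrans.toCatHom₂ (Poly.functorMap_comp f g)
  mapId X := Cat.Hom.isoMk (Poly.functorId X.obj)
  mapComp P Q := Cat.Hom.isoMk (Poly.functorComp P Q).symm
  map₂_whisker_left P _ _ η := by
    ext x
    exact Poly.functorMap_whiskerLeft P η x
  map₂_whisker_right η Q := by
    ext x
    exact Poly.functorMap_whiskerRight η Q x
  map₂_associator P Q R := by
    ext x
    refine (Poly.functorMap_associator P Q R x).trans ?_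
    -- The associator of `Cat` has identity components, which accounts for the extra factor; the
    -- unitors below behave likewise.
    exact congrArg (_ ≫ _ ≫ ·) (id_comp _).symm
  map₂_left_unitor P := by
    ext x
    refine (Poly.functorMap_leftUnitor P x).trans ?_
    exact congrArg (_ ≫ ·) (comp_id _).symm
  map₂_right_unitor P := by
    ext x
    refine (Poly.functorMap_rightUnitor P x).trans ?_
    exact congrArg (_ ≫ ·) (comp_id _).symm

end PolyCart

theorem mainTheorem2 (E : Type u) [Category.{v} E] [HasPullbacks E] :
    ∃ (mapId : ∀ X : PolyCart.PolyCat E,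
        (PolyCart.polyStruct E).map (𝟙 X) ≅ 𝟙 ((PolyCart.polyStruct E).obj X))
      (mapComp : ∀ {X Y Z : PolyCart.PolyCat E} (p : X ⟶ Y) (q : Y ⟶ Z),
        (PolyCart.polyStruct E).map (p ≫ q) ≅
          (PolyCart.polyStruct E).map p ≫ (PolyCart.polyStruct E).map q),
      (∀ (X : PolyCart.PolyCat E) (x : Over X.obj),
        (mapId X).hom.toNatTrans.app x =
          (PolyCart.Poly.rightProj x.left X.obj).map
            (PolyCart.Poly.rightUnitor (PolyCart.Poly.lft x)).hom) ∧
      (∀ {X Y Z : PolyCart.PolyCat E} (p : X ⟶ Y) (q : Y ⟶ Z) (x : Over X.obj),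
        (mapComp p q).inv.toNatTrans.app x =
          (PolyCart.Poly.rightProj x.left Z.obj).map
            (PolyCart.Poly.associator (PolyCart.Poly.lft x) p q).hom) ∧
      ∃ F : Pseudofunctor (PolyCart.PolyCat E) Cat.{v, max u v},
        F.toPrelaxFunctorStruct = PolyCart.polyStruct E ∧
        HEq @F.mapId @mapId ∧ HEq @F.mapComp @mapComp :=
  ⟨(PolyCart.polyPseudofunctor E).mapId, (PolyCart.polyPseudofunctor E).mapComp,
    fun _ _ => rfl, fun _ _ _ => rfl, PolyCart.polyPseudofunctor E, rfl, HEq.rfl, HEq.rfl⟩
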